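/- Let $d$ be a fixed dimension. In the minimum Manhattan network problem (MMN) in $d$ dimensions one is given a set $T$ of $n$ points (terminals) in $\mathbb{R}^d$. A feasible solution (a Manhattan network for $T$) is a finite collection of axis-parallel segments in $\mathbb{R}^d$ such that any two terminals $p,q\in T$ are joined by a path that lies in the union of the segments, consists of finitely many axis-parallel segments, and has total length equal to the Manhattan distance $\|p-q\|_1$. The goal is to minimize the total length of the segments. There are a constant $C>0$, depending only on $d$, and an algorithm that, for every $n\ge 1$ and every set $T\subset\mathbb{R}^d$ of $n$ terminals, runs in time polynomial in $n$ (each arithmetic operation or comparison of real numbers counting as one step) and outputs a Manhattan network for $T$ whose length is at most $C\cdot(\log n)^{d+1}$ times the length of every Manhattan network for $T$. In other words, MMN in $d$ dimensions admits an $O(\log^{d+1} n)$-approximation, where $n$ is the number of terminals. -/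

import Mathlib

/-! ### The computation model

A first-order functional language over binary trees whose leaves hold real numbers. A program is
a fixed finite expression together with finitely many recursive functions. The only operations on
numbers are integer literals, addition, subtraction and comparison. Every evaluation step is
charged one unit and takes a bounded number of operations on a real RAM, trees being stored as
pointers to cells. So a running time in this model is, up to a constant factor that depends on the
program only, a running time on a real RAM. -/

namespace RealProg

/-- Data: the empty tree, a real number, or a pair. -/
inductive Val : Type
  | nil : Val
  | num : ℝ → Val
  | pair : Val → Val → Val

/-- Expressions. Variables are de Bruijn indices into the current environment.
`letIn a b` binds the value of `a` as variable `0` of `b`.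
`split a b c` is `b` with the two components of `a` bound as variables `0` and `1` if the value
of `a` is a pair, and is `c` otherwise.
`ifLe a b c e` is `c` if the number `a` is at most the number `b`, and is `e` otherwise.
`call f a` applies the function with index `f` to the value of `a`. -/
inductive Expr : Type
  | var : ℕ → Expr
  | nil : Expr
  | lit : ℤ → Expr
  | pair : Expr → Expr → Expr
  | add : Expr → Expr → Expr
  | sub : Expr → Expr → Expr
  | letIn : Expr → Expr → Expr
  | split : Expr → Expr → Expr → Expr
  | ifLe : Expr → Expr → Expr → Expr → Expr
  | call : ℕ → Expr → Expr

/-- `Eval F ρ e v c`: with function bodies `F` and environment `ρ`, the call-by-value evaluation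
of `e` terminates with value `v` after exactly `c` steps. Evaluation gets stuck (has no result) on
ill-formed operations, such as adding a pair to a number. -/
inductive Eval (F : List Expr) : List Val → Expr → Val → ℕ → Prop
  | var {ρ : List Val} {i : ℕ} {v : Val} : ρ[i]? = some v → Eval F ρ (.var i) v 1
  | nil {ρ : List Val} : Eval F ρ .nil .nil 1
  | lit {ρ : List Val} {z : ℤ} : Eval F ρ (.lit z) (.num (z : ℝ)) 1
  | pair {ρ : List Val} {a b : Expr} {x y : Val} {m n : ℕ} :
      Eval F ρ a x m → Eval F ρ b y n → Eval F ρ (.pair a b) (.pair x y) (m + n + 1)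
  | add {ρ : List Val} {a b : Expr} {x y : ℝ} {m n : ℕ} :
      Eval F ρ a (.num x) m → Eval F ρ b (.num y) n →
      Eval F ρ (.add a b) (.num (x + y)) (m + n + 1)
  | sub {ρ : List Val} {a b : Expr} {x y : ℝ} {m n : ℕ} :
      Eval F ρ a (.num x) m → Eval F ρ b (.num y) n →
      Eval F ρ (.sub a b) (.num (x - y)) (m + n + 1)
  | letIn {ρ : List Val} {a b : Expr} {x v : Val} {m n : ℕ} :
      Eval F ρ a x m → Eval F (x :: ρ) b v n → Eval F ρ (.letIn a b) v (m + n + 1)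
  | split_pair {ρ : List Val} {a b c : Expr} {x y v : Val} {m n : ℕ} :
      Eval F ρ a (.pair x y) m → Eval F (x :: y :: ρ) b v n →
      Eval F ρ (.split a b c) v (m + n + 1)
  | split_atom {ρ : List Val} {a b c : Expr} {w v : Val} {m n : ℕ} :
      Eval F ρ a w m → (∀ x y : Val, w ≠ .pair x y) → Eval F ρ c v n →
      Eval F ρ (.split a b c) v (m + n + 1)
  | ifLe_true {ρ : List Val} {a b c e : Expr} {x y : ℝ} {v : Val} {m n k : ℕ} :
      Eval F ρ a (.num x) m → Eval F ρ b (.num y) n → x ≤ y → Eval F ρ c v k →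
      Eval F ρ (.ifLe a b c e) v (m + n + k + 1)
  | ifLe_false {ρ : List Val} {a b c e : Expr} {x y : ℝ} {v : Val} {m n k : ℕ} :
      Eval F ρ a (.num x) m → Eval F ρ b (.num y) n → ¬ x ≤ y → Eval F ρ e v k →
      Eval F ρ (.ifLe a b c e) v (m + n + k + 1)
  | call {ρ : List Val} {f : ℕ} {a body : Expr} {x v : Val} {m n : ℕ} :
      F[f]? = some body → Eval F ρ a x m → Eval F [x] body v n →
      Eval F ρ (.call f a) v (m + n + 1)

/-- The model is deterministic: result and number of steps are unique. -/
theorem Eval.deterministic {F : List Expr} {ρ : List Val} {e : Expr} {v w : Val} {m n : ℕ}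
    (h : Eval F ρ e v m) (h' : Eval F ρ e w n) : v = w ∧ m = n := by
  induction h generalizing w n with
  | var h => cases h' with | var h' => simp_all
  | nil => cases h'; simp
  | lit => cases h'; simp
  | pair _ _ ih₁ ih₂ =>
    cases h' with
    | pair h₁ h₂ =>
      obtain ⟨rfl, rfl⟩ := ih₁ h₁
      obtain ⟨rfl, rfl⟩ := ih₂ h₂
      simp
  | add _ _ ih₁ ih₂ =>
    cases h' with
    | add h₁ h₂ =>
      obtain ⟨e₁, rfl⟩ := ih₁ h₁
      obtain ⟨e₂, rfl⟩ := ih₂ h₂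
      cases e₁; cases e₂; simp
  | sub _ _ ih₁ ih₂ =>
    cases h' with
    | sub h₁ h₂ =>
      obtain ⟨e₁, rfl⟩ := ih₁ h₁
      obtain ⟨e₂, rfl⟩ := ih₂ h₂
      cases e₁; cases e₂; simp
  | letIn _ _ ih₁ ih₂ =>
    cases h' with
    | letIn h₁ h₂ =>
      obtain ⟨rfl, rfl⟩ := ih₁ h₁
      obtain ⟨rfl, rfl⟩ := ih₂ h₂
      simp
  | split_pair _ _ ih₁ ih₂ =>
    cases h' with
    | split_pair h₁ h₂ =>
      obtain ⟨e₁, rfl⟩ := ih₁ h₁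
      cases e₁
      obtain ⟨rfl, rfl⟩ := ih₂ h₂
      simp
    | split_atom h₁ hn _ => exact absurd (ih₁ h₁).1.symm (hn _ _)
  | split_atom _ hn _ ih₁ ih₂ =>
    cases h' with
    | split_pair h₁ _ => exact absurd (ih₁ h₁).1 (hn _ _)
    | split_atom h₁ _ h₂ =>
      obtain ⟨rfl, rfl⟩ := ih₁ h₁
      obtain ⟨rfl, rfl⟩ := ih₂ h₂
      simp
  | ifLe_true _ _ hle _ ih₁ ih₂ ih₃ =>
    cases h' with
    | ifLe_true h₁ h₂ _ h₃ =>
      obtain ⟨-, rfl⟩ := ih₁ h₁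
      obtain ⟨-, rfl⟩ := ih₂ h₂
      obtain ⟨rfl, rfl⟩ := ih₃ h₃
      simp
    | ifLe_false h₁ h₂ hn _ =>
      cases (ih₁ h₁).1; cases (ih₂ h₂).1
      exact absurd hle hn
  | ifLe_false _ _ hn _ ih₁ ih₂ ih₃ =>
    cases h' with
    | ifLe_true h₁ h₂ hle _ =>
      cases (ih₁ h₁).1; cases (ih₂ h₂).1
      exact absurd hle hn
    | ifLe_false h₁ h₂ _ h₃ =>
      obtain ⟨-, rfl⟩ := ih₁ h₁
      obtain ⟨-, rfl⟩ := ih₂ h₂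
      obtain ⟨rfl, rfl⟩ := ih₃ h₃
      simp
  | call hb _ _ ih₁ ih₂ =>
    cases h' with
    | call hb' h₁ h₂ =>
      obtain ⟨rfl, rfl⟩ := ih₁ h₁
      rw [hb] at hb'
      cases hb'
      obtain ⟨rfl, rfl⟩ := ih₂ h₂
      simp

/-- A program: the bodies of its functions and a main expression. In a function body, variable `0`
is the argument; in the main expression, variable `0` is the input. -/
structure Program where
  funs : List Expr
  main : Expr

/-- On input `x`, the program halts with output `v` after exactly `c` steps. -/
def Program.Halts (A : Program) (x v : Val) (c : ℕ) : Prop :=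
  Eval A.funs [x] A.main v c

/-- A list, stored as a right-nested chain of pairs that ends in `nil`. -/
def encodeList : List Val → Val
  | [] => .nil
  | x :: l => .pair x (encodeList l)

/-- A point of `ℝ^d`, stored as the list of its coordinates. -/
def encodePoint {d : ℕ} (p : Fin d → ℝ) : Val :=
  encodeList (List.ofFn fun i => .num (p i))

end RealProg

/-! ### The minimum Manhattan network problem -/

namespace Manhattan

/-- The Manhattan distance of two points. -/
noncomputable def dist₁ {d : ℕ} (p q : Fin d → ℝ) : ℝ :=
  ∑ i, |p i - q i|

/-- The segment from `p` to `q` is axis-parallel (it may be a single point). -/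
def AxisParallel {d : ℕ} (p q : Fin d → ℝ) : Prop :=
  ∃ i, ∀ j, j ≠ i → p j = q j

/-- A finite collection of segments, each given by its two endpoints. -/
abbrev Network (d : ℕ) : Type :=
  List ((Fin d → ℝ) × (Fin d → ℝ))

/-- The set of points covered by a network. -/
def Network.support {d : ℕ} (N : Network d) : Set (Fin d → ℝ) :=
  {x | ∃ s ∈ N, x ∈ segment ℝ s.1 s.2}

/-- All segments of the network are axis-parallel. -/
def Network.IsRectilinear {d : ℕ} (N : Network d) : Prop :=
  ∀ s ∈ N, AxisParallel s.1 s.2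

/-- The total length of the segments. Parts that several segments cover are counted repeatedly;
since a network can always be subdivided into segments without such overlaps, the infimum of the
lengths of feasible networks is the same as if they were counted once. -/
noncomputable def Network.length {d : ℕ} (N : Network d) : ℝ :=
  (N.map fun s => dist₁ s.1 s.2).sum

/-- `RectPath S p q L`: there is a path from `p` to `q` inside `S` that consists of finitely many
axis-parallel segments of total length `L`. -/
inductive RectPath {d : ℕ} (S : Set (Fin d → ℝ)) : (Fin d → ℝ) → (Fin d → ℝ) → ℝ → Prop
  | refl (p : Fin d → ℝ) : RectPath S p p 0
  | cons {p q r : Fin d → ℝ} {L : ℝ} : AxisParallel p q → segment ℝ p q ⊆ S →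
      RectPath S q r L → RectPath S p r (dist₁ p q + L)

/-- `p` and `q` are connected in `N` by a Manhattan path: a path of axis-parallel segments whose
total length is the Manhattan distance of `p` and `q`. -/
def Network.MConnects {d : ℕ} (N : Network d) (p q : Fin d → ℝ) : Prop :=
  RectPath N.support p q (dist₁ p q)

/-- `N` is a Manhattan network for the terminals `t 0, …, t (n - 1)`, that is, a feasible solution
of the minimum Manhattan network problem. -/
def IsManhattanNetwork {d n : ℕ} (t : Fin n → Fin d → ℝ) (N : Network d) : Prop :=
  N.IsRectilinear ∧ ∀ i j, N.MConnects (t i) (t j)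

/-- Input format: the list of the terminals. -/
def encodeTerminals {d n : ℕ} (t : Fin n → Fin d → ℝ) : RealProg.Val :=
  RealProg.encodeList (List.ofFn fun i => RealProg.encodePoint (t i))

/-- Output format: the list of the segments, each as the pair of its endpoints. -/
def encodeNetwork {d : ℕ} (N : Network d) : RealProg.Val :=
  RealProg.encodeList
    (N.map fun s => .pair (RealProg.encodePoint s.1) (RealProg.encodePoint s.2))

/-- The minimum Manhattan network problem in `d` dimensions admits a `ρ(n)`-approximation: there
is a polynomial-time algorithm that computes, for every set of `n` terminals (presented as a list
in any order), a Manhattan network whose length is at most `ρ n` times that of any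
Manhattan network for the same terminals. -/
def AdmitsApproximation (d : ℕ) (ρ : ℕ → ℝ) : Prop :=
  ∃ (A : RealProg.Program) (P : Polynomial ℕ),
    ∀ (n : ℕ) (t : Fin n → Fin d → ℝ), Function.Injective t →
      ∃ (N : Network d) (c : ℕ),
        A.Halts (encodeTerminals t) (encodeNetwork N) c ∧ c ≤ P.eval n ∧
        IsManhattanNetwork t N ∧
        ∀ N' : Network d, IsManhattanNetwork t N' → N.length ≤ ρ n * N'.length

end Manhattan

namespace Manhattan

/-! ### Geometry of the Manhattan distance -/

/-! The network is built by divide and conquer over the coordinates, and its length is charged to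
the 1-dimensional Hausdorff measure of an arbitrary feasible network. Measuring the covered set
rather than summing segments allows it to be cut by hyperplanes.

At level 0 (`good_zero`) a centre `o` is given, and only pairs whose box contains `o` must be
joined. Any set `W` connecting the points carries a path through all of them of length at most `2 *
μH[1] W` (`exists_perm_plen_le`); nearest insertion finds an order at most twice as long as the best
one (`PrimCost.le_plen`, `runs_prim`), hence at most `4 * μH[1] W`. Along this order neighbouring
points are merged into their median with `o`. A round costs at most the length of the current path,
does not lengthen it, and halves the number of points, so about `log n` rounds leave one point `f`
(`Rounds.length_le`). Every point reaches `f` while only approaching `o`; if `o` lies in the box of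
`p` and `q`, the two paths combine to a Manhattan path (`Rounds.connects`).

From level `j` to `j + 1` (`Good.step`) the points are split at a median `c` of coordinate `j`.
Pairs with `c` between their coordinates are served by level `j`, with `c` as coordinate `j` of the
centre; the others lie strictly on one side and are treated recursively. Manhattan paths never leave
a box containing their ends (`RectPath.inter`), so the two sides are charged to disjoint parts of
the feasible network. One recursion depth therefore costs one level-`j` bound, and each level
contributes a factor `log n`. At level `d` no condition on the centre remains, so all pairs are
joined: `d` factors from the levels and one from the merging. -/

theorem dist₁_nonneg {d : ℕ} (p q : Fin d → ℝ) : 0 ≤ dist₁ p q :=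
  Finset.sum_nonneg fun _ _ => abs_nonneg _

@[simp] theorem dist₁_self {d : ℕ} (p : Fin d → ℝ) : dist₁ p p = 0 := by
  simp [dist₁]

theorem dist₁_comm {d : ℕ} (p q : Fin d → ℝ) : dist₁ p q = dist₁ q p :=
  Finset.sum_congr rfl fun _ _ => abs_sub_comm _ _

theorem dist₁_triangle {d : ℕ} (p q r : Fin d → ℝ) : dist₁ p r ≤ dist₁ p q + dist₁ q r := by
  unfold dist₁
  rw [← Finset.sum_add_distrib]
  exact Finset.sum_le_sum fun _ _ => abs_sub_le _ _ _

theorem eq_of_dist₁_eq_zero {d : ℕ} {p q : Fin d → ℝ} (h : dist₁ p q = 0) : p = q := by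
  funext i
  have := (Finset.sum_eq_zero_iff_of_nonneg fun _ _ => abs_nonneg _).1 h i (Finset.mem_univ i)
  linarith [abs_eq_zero.1 this]

/-- `m` lies in the box spanned by `a` and `b`. -/
def Btw {d : ℕ} (a m b : Fin d → ℝ) : Prop :=
  ∀ i, m i ∈ Set.uIcc (a i) (b i)

theorem abs_sub_add_abs_sub_of_mem_uIcc {a m b : ℝ} (h : m ∈ Set.uIcc a b) :
    |a - m| + |m - b| = |a - b| := by
  rcases Set.mem_uIcc.1 h with ⟨h1, h2⟩ | ⟨h1, h2⟩
  · rw [abs_of_nonpos (by linarith), abs_of_nonpos (by linarith), abs_of_nonpos (by linarith)]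
    ring
  · rw [abs_of_nonneg (by linarith), abs_of_nonneg (by linarith), abs_of_nonneg (by linarith)]
    ring

theorem mem_uIcc_of_abs_sub_add_abs_sub {a m b : ℝ} (h : |a - m| + |m - b| ≤ |a - b|) :
    m ∈ Set.uIcc a b := by
  rw [Set.mem_uIcc]
  by_contra hc
  push Not at hc
  rcases le_total a b with hab | hab
  · rw [abs_of_nonpos (by linarith : a - b ≤ 0)] at h
    rcases lt_or_ge m a with h1 | h1
    · linarith [le_abs_self (a - m), neg_le_abs (m - b)]
    · linarith [hc.1 h1, le_abs_self (m - b), neg_le_abs (a - m)]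
  · rw [abs_of_nonneg (by linarith : 0 ≤ a - b)] at h
    rcases lt_or_ge m b with h1 | h1
    · linarith [le_abs_self (a - m), neg_le_abs (m - b)]
    · linarith [hc.2 h1, le_abs_self (m - b), neg_le_abs (a - m)]

namespace Btw

variable {d : ℕ} {a b m n o : Fin d → ℝ}

theorem dist_add (h : Btw a m b) : dist₁ a m + dist₁ m b = dist₁ a b := by
  unfold dist₁
  rw [← Finset.sum_add_distrib]
  exact Finset.sum_congr rfl fun i _ => abs_sub_add_abs_sub_of_mem_uIcc (h i)

/-- Equality in the summed triangle inequality forces equality in each coordinate. -/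
theorem of_dist_le (h : dist₁ a m + dist₁ m b ≤ dist₁ a b) : Btw a m b := by
  intro i
  apply mem_uIcc_of_abs_sub_add_abs_sub
  unfold dist₁ at h
  rw [← Finset.sum_add_distrib] at h
  have h2 := (Finset.sum_eq_sum_iff_of_le (s := Finset.univ)
    (f := fun i => |a i - b i|) (g := fun i => |a i - m i| + |m i - b i|)
    fun i _ => abs_sub_le _ _ _).1
    (le_antisymm (Finset.sum_le_sum fun i _ => abs_sub_le _ _ _) h)
  exact (h2 i (Finset.mem_univ i)).ge

theorem left (a b : Fin d → ℝ) : Btw a a b := fun _ => Set.left_mem_uIcc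

theorem trans_right (h : Btw a m o) (h' : Btw m n o) : Btw a n o := fun i =>
  Set.uIcc_subset_uIcc_right (h i) (h' i)

theorem inner (h : Btw a m o) (h' : Btw m n o) : Btw a m n := by
  intro i
  have h1 := h i
  have h2 := h' i
  simp only [Set.mem_uIcc] at *
  grind

/-- In each coordinate `a` and `b` lie on opposite sides of `o`, so a value between each of them and
`o` must equal that of `o`. -/
theorem of_common (h : Btw a o b) (h1 : Btw a m o) (h2 : Btw b m o) : Btw a m b := by
  intro i
  have h := h i
  have h1 := h1 i
  have h2 := h2 i
  simp only [Set.mem_uIcc] at *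
  grind

end Btw

theorem mem_segment_btw {d : ℕ} {a b x : Fin d → ℝ} (h : x ∈ segment ℝ a b) : Btw a x b := by
  intro i
  obtain ⟨s, t, hs, ht, hst, rfl⟩ := h
  apply segment_subset_uIcc (𝕜 := ℝ)
  exact ⟨s, t, hs, ht, hst, by simp⟩

/-! ### Manhattan paths -/

namespace RectPath

variable {d : ℕ} {S S' : Set (Fin d → ℝ)} {p q r : Fin d → ℝ} {L L' : ℝ}

theorem mono (h : S ⊆ S') (hp : RectPath S p q L) : RectPath S' p q L := by
  induction hp with
  | refl p => exact .refl p
  | cons ha hs _ ih => exact .cons ha (hs.trans h) ih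

theorem trans (h : RectPath S p q L) (h' : RectPath S q r L') : RectPath S p r (L + L') := by
  induction h with
  | refl p => simpa using h'
  | cons ha hs _ ih => rw [add_assoc]; exact .cons ha hs (ih h')

theorem single (ha : AxisParallel p q) (hs : segment ℝ p q ⊆ S) :
    RectPath S p q (dist₁ p q) := by
  simpa using RectPath.cons ha hs (.refl q)

end RectPath

theorem AxisParallel.symm {d : ℕ} {p q : Fin d → ℝ} (h : AxisParallel p q) : AxisParallel q p :=
  h.imp fun _ hi j hj => (hi j hj).symm

namespace RectPath

variable {d : ℕ} {S S' : Set (Fin d → ℝ)} {p q r : Fin d → ℝ} {L L' : ℝ}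

theorem symm (h : RectPath S p q L) : RectPath S q p L := by
  induction h with
  | refl p => exact .refl p
  | @cons p q r L ha hs _ ih =>
    rw [add_comm, dist₁_comm]
    exact ih.trans (single ha.symm (by rwa [segment_symm]))

theorem dist_le (h : RectPath S p q L) : dist₁ p q ≤ L := by
  induction h with
  | refl p => simp
  | @cons p q r L ha hs _ ih => linarith [dist₁_triangle p q r]

theorem eq_or_mem (h : RectPath S p q L) : p = q ∨ p ∈ S := by
  cases h with
  | refl => exact .inl rfl
  | cons _ hs _ => exact .inr (hs (left_mem_segment ℝ _ _))

/-- A shortest path stays in every box-closed set that contains its endpoints. -/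
theorem inter {R : Set (Fin d → ℝ)} (hR : ∀ a ∈ R, ∀ b ∈ R, ∀ m, Btw a m b → m ∈ R)
    (h : RectPath S p q L) (hL : L ≤ dist₁ p q) (hp : p ∈ R) (hq : q ∈ R) :
    RectPath (S ∩ R) p q L := by
  induction h with
  | refl p => exact .refl p
  | @cons p q r L ha hs h' ih =>
    have h1 := h'.dist_le
    -- A path no longer than the distance of its ends has its first corner between them, and the
    -- remaining path is again shortest.
    have hb : Btw p q r := .of_dist_le (by linarith)
    have hqR : q ∈ R := hR p hp r hq q hb
    refine .cons ha (Set.subset_inter hs fun x hx => hR p hp q hqR x (mem_segment_btw hx))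
      (ih ?_ hqR hq)
    linarith [hb.dist_add]

end RectPath

/-! ### Connections and lengths in networks -/

namespace Network

variable {d : ℕ} {N N' : Network d} {p q r : Fin d → ℝ}

theorem MConnects.mono (h : ∀ s ∈ N, s ∈ N') (hp : N.MConnects p q) : N'.MConnects p q :=
  RectPath.mono (fun _ hx => hx.imp fun s hs => ⟨h s hs.1, hs.2⟩) hp

theorem MConnects.symm (h : N.MConnects p q) : N.MConnects q p := by
  unfold MConnects
  rw [dist₁_comm]
  exact RectPath.symm h

theorem MConnects.trans (hb : Btw p q r) (h : N.MConnects p q) (h' : N.MConnects q r) :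
    N.MConnects p r := by
  unfold MConnects
  rw [← hb.dist_add]
  exact RectPath.trans h h'

theorem MConnects.refl (N : Network d) (p : Fin d → ℝ) : N.MConnects p p := by
  unfold MConnects
  rw [dist₁_self]
  exact .refl p

theorem length_append (N N' : Network d) : Network.length (N ++ N') = N.length + N'.length := by
  simp [Network.length]

theorem length_nonneg (N : Network d) : 0 ≤ N.length :=
  List.sum_nonneg (by simp only [List.mem_map]; rintro _ ⟨s, _, rfl⟩; exact dist₁_nonneg _ _)

theorem length_nil : Network.length ([] : Network d) = 0 := rfl

theorem IsRectilinear.append (h : N.IsRectilinear) (h' : N'.IsRectilinear) :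
    Network.IsRectilinear (N ++ N') := by
  intro s hs
  rcases List.mem_append.1 hs with hs | hs
  exacts [h s hs, h' s hs]

end Network

/-! ### Staircases -/

/-- The point with the first `k` coordinates of `b` and the other coordinates of `a`. -/
def mix {d : ℕ} (k : ℕ) (a b : Fin d → ℝ) : Fin d → ℝ :=
  fun i => if (i : ℕ) < k then b i else a i

/-- A Manhattan path from `a` to `b`, with one segment for each coordinate. -/
def stair {d : ℕ} (a b : Fin d → ℝ) : Network d :=
  List.ofFn fun k : Fin d => (mix k a b, mix (k + 1) a b)

theorem mix_eq_of_ne {d : ℕ} (a b : Fin d → ℝ) (k : Fin d) {j : Fin d} (hj : j ≠ k) :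
    mix k a b j = mix (k + 1) a b j := by
  have : (j : ℕ) ≠ k := fun h => hj (Fin.ext h)
  unfold mix
  split_ifs <;> first | rfl | omega

theorem axisParallel_mix {d : ℕ} (a b : Fin d → ℝ) (k : Fin d) :
    AxisParallel (mix k a b) (mix (k + 1) a b) :=
  ⟨k, fun _ hj => mix_eq_of_ne a b k hj⟩

theorem stair_isRectilinear {d : ℕ} (a b : Fin d → ℝ) : (stair a b).IsRectilinear := by
  intro s hs
  obtain ⟨k, rfl⟩ := List.mem_ofFn' _ _ |>.1 hs
  exact axisParallel_mix a b k

theorem stair_length {d : ℕ} (a b : Fin d → ℝ) : (stair a b).length = dist₁ a b := by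
  unfold Network.length stair
  rw [List.map_ofFn, List.sum_ofFn]
  refine Finset.sum_congr rfl fun k _ => ?_
  simp only [Function.comp, dist₁]
  rw [Finset.sum_eq_single k]
  · simp [mix]
  · intro j _ hj
    rw [mix_eq_of_ne a b k hj]; simp
  · simp

theorem mix_succ_btw {d : ℕ} (k : ℕ) (a b : Fin d → ℝ) :
    Btw a (mix k a b) (mix (k + 1) a b) := by
  intro i
  unfold mix
  split_ifs <;> first | omega | simp

theorem stair_connects {d : ℕ} (a b : Fin d → ℝ) : (stair a b).MConnects a b := by
  have key : ∀ k ≤ d, (stair a b).MConnects a (mix k a b) := by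
    intro k
    induction k with
    | zero =>
      intro _
      have : mix 0 a b = a := by funext i; simp [mix]
      rw [this]
      exact .refl _ _
    | succ k ih =>
      intro hk
      refine (ih (by omega)).trans (mix_succ_btw k a b) ?_
      refine RectPath.single (axisParallel_mix a b ⟨k, hk⟩)
        fun x hx => ⟨(mix k a b, mix (k + 1) a b), ?_, hx⟩
      exact (List.mem_ofFn' _ _).2 ⟨⟨k, hk⟩, rfl⟩
  have : mix d a b = b := by funext i; simp [mix]
  simpa [this] using key d le_rfl

/-- This is the recursion on the dimension that `stairBody` executes. -/
theorem stair_succ {d : ℕ} (a b : Fin (d + 1) → ℝ) :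
    stair a b = (a, Fin.cons (b 0) (Fin.tail a)) ::
      (stair (Fin.tail a) (Fin.tail b)).map fun s => (Fin.cons (b 0) s.1, Fin.cons (b 0) s.2) := by
  have h (k : ℕ) : mix (k + 1) a b = Fin.cons (b 0) (mix k (Fin.tail a) (Fin.tail b)) := by
    funext i
    refine Fin.cases ?_ (fun i => ?_) i
    · simp [mix]
    · simp [mix, Fin.tail]
  have h0 : mix 0 a b = a := by funext i; simp [mix]
  have h1 : mix 0 (Fin.tail a) (Fin.tail b) = Fin.tail a := by funext i; simp [mix]
  unfold stair
  rw [List.ofFn_succ, List.map_ofFn]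
  simp only [Fin.val_zero, Fin.val_succ, h0, h, h1, Function.comp_def]

/-! ### Lengths of sequences of points -/

/-- The length of the polygonal path through the points of a list. -/
noncomputable def plen {d : ℕ} : List (Fin d → ℝ) → ℝ
  | [] => 0
  | [_] => 0
  | a :: b :: l => dist₁ a b + plen (b :: l)

section plen

variable {d : ℕ}

@[simp] theorem plen_nil : plen ([] : List (Fin d → ℝ)) = 0 := rfl

@[simp] theorem plen_singleton (a : Fin d → ℝ) : plen [a] = 0 := rfl

@[simp] theorem plen_cons_cons (a b : Fin d → ℝ) (l : List (Fin d → ℝ)) :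
    plen (a :: b :: l) = dist₁ a b + plen (b :: l) := rfl

theorem plen_nonneg : ∀ l : List (Fin d → ℝ), 0 ≤ plen l
  | [] => le_rfl
  | [_] => le_rfl
  | a :: b :: l => add_nonneg (dist₁_nonneg a b) (plen_nonneg (b :: l))

theorem plen_append_cons (a : Fin d → ℝ) (l' : List (Fin d → ℝ)) :
    ∀ l : List (Fin d → ℝ), plen (l ++ a :: l') = plen (l ++ [a]) + plen (a :: l')
  | [] => by simp
  | [b] => by simp
  | b :: c :: l => by
    have := plen_append_cons a l' (c :: l)
    simp only [List.cons_append, plen_cons_cons] at *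
    rw [this]; ring

theorem plen_tail_le (a : Fin d → ℝ) : ∀ l, plen l ≤ plen (a :: l)
  | [] => le_rfl
  | b :: l => by simp [dist₁_nonneg]

theorem plen_cons_le (a b : Fin d → ℝ) : ∀ l, plen (a :: l) ≤ dist₁ a b + plen (b :: l)
  | [] => by simp [dist₁_nonneg]
  | c :: l => by simp only [plen_cons_cons]; linarith [dist₁_triangle a b c]

/-- Shortcutting by the triangle inequality. The second clause, with a fixed start, carries the
induction. -/
theorem plen_sublist {l l' : List (Fin d → ℝ)} (h : l.Sublist l') :
    plen l ≤ plen l' ∧ ∀ a, plen (a :: l) ≤ plen (a :: l') := by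
  induction h with
  | slnil => simp
  | @cons l l' b h ih =>
    refine ⟨ih.1.trans (plen_tail_le b l'), fun a => ?_⟩
    simp only [plen_cons_cons]
    linarith [ih.2 b, plen_cons_le a b l]
  | @cons_cons l l' b h ih =>
    refine ⟨ih.2 b, fun a => ?_⟩
    simp only [plen_cons_cons]
    linarith [ih.2 b]

theorem plen_reverse (l : List (Fin d → ℝ)) : plen l.reverse = plen l := by
  induction l with
  | nil => rfl
  | cons a l ih =>
    cases l with
    | nil => rfl
    | cons b l =>
      simp only [List.reverse_cons, List.append_assoc, List.singleton_append,
        plen_cons_cons] at ih ⊢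
      rw [plen_append_cons, ih, plen_cons_cons, plen_singleton, dist₁_comm]
      ring

/-- Inserting `u` after `v` costs at most twice their distance. -/
theorem plen_insert_le (l : List (Fin d → ℝ)) (v u : Fin d → ℝ) (l' : List (Fin d → ℝ)) :
    plen (l ++ v :: u :: l') ≤ plen (l ++ v :: l') + 2 * dist₁ u v := by
  rw [plen_append_cons, plen_append_cons v l' l, plen_cons_cons, dist₁_comm v u]
  linarith [plen_cons_le u v l']

/-- Tours grow by such detours; walking each one out and back is the source of the factor 2 in
`IsTour`. -/
theorem plen_spur (l : List (Fin d → ℝ)) (v u : Fin d → ℝ) (l' : List (Fin d → ℝ)) :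
    plen (l ++ v :: u :: v :: l') = plen (l ++ v :: l') + 2 * dist₁ v u := by
  rw [plen_append_cons, plen_append_cons v l' l, plen_cons_cons, plen_cons_cons, dist₁_comm u v]
  ring

end plen

/-! ### Short tours inside a connected set -/

section tours

open MeasureTheory Measure

variable {d : ℕ}

/-- The points covered by the polygonal path through a list of points. -/
def psupp : List (Fin d → ℝ) → Set (Fin d → ℝ)
  | [] => ∅
  | [a] => {a}
  | a :: b :: l => segment ℝ a b ∪ psupp (b :: l)

theorem segment_subset_union_of_mem {E : Type*} [AddCommGroup E] [Module ℝ E] {a b y : E}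
    (hy : y ∈ segment ℝ a b) : segment ℝ a b ⊆ segment ℝ a y ∪ segment ℝ y b := by
  intro x hx
  rw [segment_eq_image_lineMap] at hx hy
  obtain ⟨t, ht, rfl⟩ := hy
  obtain ⟨s, hs, rfl⟩ := hx
  have h (u v w : ℝ) (huv : u ≤ w) (hw : w ≤ v) : AffineMap.lineMap a b w ∈
      segment ℝ (AffineMap.lineMap a b u : E) (AffineMap.lineMap a b v) := by
    rw [← image_segment ℝ (AffineMap.lineMap a b : ℝ →ᵃ[ℝ] E)]
    refine ⟨w, ?_, rfl⟩
    rw [segment_eq_Icc (huv.trans hw)]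
    exact ⟨huv, hw⟩
  rcases le_total s t with hst | hst
  · left
    simpa using h 0 t s hs.1 hst
  · right
    simpa using h t 1 s hst hs.2

theorem left_mem_psupp (a : Fin d → ℝ) : ∀ l, a ∈ psupp (a :: l)
  | [] => rfl
  | b :: _ => Or.inl (left_mem_segment ℝ a b)

theorem psupp_append_cons (a : Fin d → ℝ) (l' : List (Fin d → ℝ)) :
    ∀ l : List (Fin d → ℝ), psupp (l ++ a :: l') = psupp (l ++ [a]) ∪ psupp (a :: l')
  | [] => by
    simpa [psupp] using (Set.insert_eq_of_mem (left_mem_psupp a l')).symm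
  | [b] => by
    have : {a} ⊆ segment ℝ b a := by simpa using right_mem_segment ℝ b a
    simp only [List.cons_append, List.nil_append, psupp]
    rw [Set.union_eq_self_of_subset_right this]
  | b :: c :: l => by
    have := psupp_append_cons a l' (c :: l)
    simp only [List.cons_append, psupp] at *
    rw [this, Set.union_assoc]

/-- A point of a polygonal path can be made a vertex. -/
theorem exists_insert_vertex {y : Fin d → ℝ} : ∀ {l : List (Fin d → ℝ)}, y ∈ psupp l →
    ∃ l₁ l₂, plen (l₁ ++ y :: l₂) = plen l ∧ psupp l ⊆ psupp (l₁ ++ y :: l₂) ∧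
      (∀ x, x ∈ l₁ ++ y :: l₂ ↔ x ∈ l ∨ x = y) ∧
      (∀ a l', l = a :: l' → ∃ l'', l₁ ++ y :: l₂ = a :: l'')
  | [], h => h.elim
  | [a], h => by
    obtain rfl : y = a := h
    exact ⟨[], [], rfl, subset_rfl, by simp, fun a l' h => ⟨l', h⟩⟩
  | a :: b :: l, h => by
    rcases h with h | h
    · refine ⟨[a], b :: l, ?_, ?_, ?_, ?_⟩
      · simp only [List.singleton_append, plen_cons_cons]
        rw [← (mem_segment_btw h).dist_add, add_assoc]
      · simp only [List.singleton_append, psupp]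
        rw [← Set.union_assoc]
        exact Set.union_subset_union_left _ (segment_subset_union_of_mem h)
      · simp; tauto
      · rintro _ _ ⟨⟩
        exact ⟨_, rfl⟩
    · obtain ⟨l₁, l₂, h1, h2, h3, h4⟩ := exists_insert_vertex h
      -- The unchanged head keeps the segment leaving `a` intact.
      obtain ⟨l'', h4⟩ := h4 b l rfl
      rw [h4] at h1 h2
      refine ⟨a :: l₁, l₂, ?_, ?_, ?_, ?_⟩
      · simp [h4, h1]
      · simp only [List.cons_append, h4, psupp]
        exact Set.union_subset_union_right _ h2
      · intro x
        rw [List.cons_append, List.mem_cons, h3, List.mem_cons (l := b :: l), or_assoc]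
      · rintro _ _ ⟨⟩
        exact ⟨_, rfl⟩

/-- Hausdorff measure here refers to the sup metric. Only one coordinate varies along an
axis-parallel segment, so sup length and Manhattan length agree. -/
theorem edist_eq_of_axisParallel {p q : Fin d → ℝ} (h : AxisParallel p q) :
    edist p q = ENNReal.ofReal (dist₁ p q) := by
  obtain ⟨i, hi⟩ := h
  have h1 : dist₁ p q = |p i - q i| := by
    unfold dist₁
    rw [Finset.sum_eq_single i]
    · intro j _ hj; simp [hi j hj]
    · simp
  rw [edist_dist, h1]
  congr 1
  apply le_antisymm
  · rw [dist_pi_le_iff (abs_nonneg _)]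
    intro j
    rw [Real.dist_eq]
    by_cases hj : j = i
    · rw [hj]
    · simp [hi j hj]
  · rw [← Real.dist_eq]
    exact dist_le_pi_dist p q i

theorem isCompact_segment (a b : Fin d → ℝ) : IsCompact (segment ℝ a b) := by
  rw [segment_eq_image_lineMap]
  exact isCompact_Icc.image AffineMap.lineMap_continuous

/-- A polygonal path `l` inside `W` that covers the closed set `Y` and has at most twice its
length. -/
structure IsTour (W Y : Set (Fin d → ℝ)) (l : List (Fin d → ℝ)) : Prop where
  closed : IsClosed Y
  subset : Y ⊆ W
  cover : Y ⊆ psupp l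
  mem : ∀ x ∈ l, x ∈ Y
  len : ENNReal.ofReal (plen l) ≤ 2 * μH[1] Y

/-- Only the piece from the last point `y` of `Y` on the way to `b` is new. It meets `Y` in `y`
alone, so the measure grows by exactly its length, while the detour from `y` to `b` and back costs
twice that. -/
theorem IsTour.add_segment {W Y : Set (Fin d → ℝ)} {l : List (Fin d → ℝ)} (h : IsTour W Y l)
    {a b : Fin d → ℝ} (ha : a ∈ Y) (hab : AxisParallel a b) (hW : segment ℝ a b ⊆ W) :
    ∃ Y' l', IsTour W Y' l' ∧ Y ⊆ Y' ∧ (∀ x ∈ l, x ∈ l') ∧ b ∈ l' := by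
  obtain ⟨y, ⟨hy, hyY⟩, hmin⟩ := ((isCompact_segment a b).inter_right h.closed).exists_isMinOn
    ⟨a, left_mem_segment ℝ a b, ha⟩ (f := fun z => dist₁ z b)
    (by unfold dist₁; fun_prop)
  have hsub : segment ℝ y b ⊆ segment ℝ a b :=
    (convex_segment a b).segment_subset hy (right_mem_segment ℝ a b)
  have hinter : Y ∩ segment ℝ y b ⊆ {y} := by
    rintro z ⟨hzY, hz⟩
    have h1 : dist₁ y b ≤ dist₁ z b := hmin ⟨hsub hz, hzY⟩
    have h2 := (mem_segment_btw hz).dist_add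
    have h3 := dist₁_nonneg y z
    exact (eq_of_dist₁_eq_zero (by linarith)).symm
  have hyb : AxisParallel y b := by
    obtain ⟨i, hi⟩ := hab
    refine ⟨i, fun j hj => ?_⟩
    have := mem_segment_btw hy j
    rw [hi j hj] at this
    simpa using this
  have hmeas : μH[1] (Y ∪ segment ℝ y b) = μH[1] Y + ENNReal.ofReal (dist₁ y b) := by
    rw [measure_union₀ (isCompact_segment y b).isClosed.nullMeasurableSet,
      hausdorffMeasure_segment, edist_eq_of_axisParallel hyb]
    have : μH[1] ({y} : Set (Fin d → ℝ)) = 0 := by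
      simpa using hausdorffMeasure_segment y y
    exact measure_mono_null hinter this
  obtain ⟨l₁, l₂, hl, hsupp, hmem, -⟩ := exists_insert_vertex (h.cover hyY)
  refine ⟨Y ∪ segment ℝ y b, l₁ ++ y :: b :: y :: l₂, ⟨?_, ?_, ?_, ?_, ?_⟩,
    Set.subset_union_left, ?_, by simp⟩
  · exact h.closed.union (isCompact_segment y b).isClosed
  · exact Set.union_subset h.subset (hsub.trans hW)
  · rw [psupp_append_cons]
    rw [psupp_append_cons] at hsupp
    simp only [psupp]
    have := h.cover.trans hsupp
    grind
  · intro x hx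
    have hx' : x ∈ l₁ ++ y :: l₂ ∨ x = b := by
      simp only [List.mem_append, List.mem_cons] at hx ⊢; tauto
    rcases hx' with hx' | rfl
    · rcases (hmem x).1 hx' with hx' | rfl
      exacts [Or.inl (h.mem x hx'), Or.inl hyY]
    · exact Or.inr (right_mem_segment ℝ y x)
  · rw [plen_spur, hl, hmeas, mul_add, ENNReal.ofReal_add (plen_nonneg l)
      (by linarith [dist₁_nonneg y b]), ENNReal.ofReal_mul (by norm_num)]
    have := h.len
    gcongr
    simp
  · intro x hx
    have := (hmem x).2 (Or.inl hx)
    simp only [List.mem_append, List.mem_cons] at this ⊢; tauto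

theorem IsTour.add_path {W Y : Set (Fin d → ℝ)} {l : List (Fin d → ℝ)} (h : IsTour W Y l)
    {q p : Fin d → ℝ} {L : ℝ} (hp : p ∈ Y) (hqp : RectPath W q p L) :
    ∃ Y' l', IsTour W Y' l' ∧ Y ⊆ Y' ∧ (∀ x ∈ l, x ∈ l') ∧ q ∈ l' := by
  induction hqp with
  | refl p =>
    -- A degenerate segment makes `p` a vertex. In dimension 0 there is no axis to which it could be
    -- parallel, so the vertex is inserted directly.
    by_cases hd : Nonempty (Fin d)
    · obtain ⟨i⟩ := hd
      exact h.add_segment hp ⟨i, fun _ _ => rfl⟩ (by simpa using h.subset hp)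
    · obtain ⟨l₁, l₂, hl, hsupp, hmem, -⟩ := exists_insert_vertex (h.cover hp)
      refine ⟨Y, _, ⟨h.closed, h.subset, h.cover.trans hsupp, ?_, hl ▸ h.len⟩, subset_rfl,
        fun x hx => (hmem x).2 (Or.inl hx), by simp⟩
      intro x hx
      rcases (hmem x).1 hx with hx | rfl
      exacts [h.mem x hx, hp]
  | @cons q r p L hqr hs _ ih =>
    obtain ⟨Y', l', h', hY, hl, hr⟩ := ih hp
    obtain ⟨Y'', l'', h'', hY', hl', hq⟩ := h'.add_segment (h'.mem r hr) hqr.symm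
      (by rwa [segment_symm])
    exact ⟨Y'', l'', h'', hY.trans hY', fun x hx => hl' x (hl x hx), hq⟩

/-- Points that are pairwise connected inside `W` are visited by a path of at most twice the
length of `W`. -/
theorem exists_tour {W : Set (Fin d → ℝ)} {p : Fin d → ℝ} (hp : p ∈ W) :
    ∀ S : List (Fin d → ℝ), (∀ q ∈ S, ∃ L, RectPath W q p L) →
      ∃ Y l, IsTour W Y l ∧ p ∈ Y ∧ ∀ q ∈ p :: S, q ∈ l
  | [], _ => ⟨{p}, [p], ⟨isClosed_singleton, by simpa using hp, subset_rfl, by simp, by simp⟩,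
      rfl, by simp⟩
  | q :: S, h => by
    obtain ⟨Y, l, hl, hpY, hS⟩ := exists_tour hp S fun q hq => h q (List.mem_cons_of_mem _ hq)
    obtain ⟨L, hL⟩ := h q List.mem_cons_self
    obtain ⟨Y', l', hl', hY, hll, hq⟩ := hl.add_path hpY hL
    refine ⟨Y', l', hl', hY hpY, fun x hx => ?_⟩
    rcases List.mem_cons.1 hx with rfl | hx
    · exact hll _ (hS _ List.mem_cons_self)
    · rcases List.mem_cons.1 hx with rfl | hx
      exacts [hq, hll _ (hS _ (List.mem_cons_of_mem _ hx))]

/-- Keeping one occurrence of each point of `S` in a tour only shortens it. -/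
theorem exists_perm_plen_le {W : Set (Fin d → ℝ)} (hW : μH[1] W ≠ ⊤)
    {S : List (Fin d → ℝ)} (hS : S.Nodup)
    (hconn : ∀ p ∈ S, ∀ q ∈ S, ∃ L, RectPath W p q L) :
    ∃ l, l.Perm S ∧ plen l ≤ 2 * (μH[1] : Measure (Fin d → ℝ)).real W := by
  classical
  match S with
  | [] => exact ⟨[], .refl _, by simp⟩
  | [p] => exact ⟨[p], .refl _, by simp⟩
  | p :: q :: S =>
    obtain ⟨L, hL⟩ := hconn p (by simp) q (by simp)
    -- A path to a different point starts inside `W`. A lone point need not lie in `W`, hence the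
    -- separate case above.
    have hpW : p ∈ W := hL.eq_or_mem.resolve_left fun h => by simp [h] at hS
    obtain ⟨Y, l, hl, -, hmem⟩ := exists_tour hpW (q :: S) fun q hq =>
      hconn q (List.mem_cons_of_mem _ hq) p List.mem_cons_self
    refine ⟨(l.filter (· ∈ p :: q :: S)).dedup, ?_, ?_⟩
    · rw [List.perm_ext_iff_of_nodup (List.nodup_dedup _) hS]
      intro x
      rw [List.mem_dedup, List.mem_filter]
      simp only [decide_eq_true_eq]
      exact ⟨fun h => h.2, fun h => ⟨hmem x h, h⟩⟩
    · refine (plen_sublist ((List.dedup_sublist _).trans List.filter_sublist)).1.trans ?_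
      have h1 := hl.len.trans (mul_le_mul_right (measure_mono hl.subset) 2)
      rw [ENNReal.ofReal_le_iff_le_toReal (by finiteness)] at h1
      simpa [Measure.real] using h1

theorem Network.measure_support_le {N : Network d} (hN : N.IsRectilinear) :
    μH[1] N.support ≤ ENNReal.ofReal N.length := by
  induction N with
  | nil => simp [Network.support]
  | cons s N ih =>
    have h1 : Network.support (s :: N) = segment ℝ s.1 s.2 ∪ Network.support N := by
      ext x; simp [Network.support]
    have h0 : 0 ≤ Network.length N := Network.length_nonneg N
    have h2 : Network.length (s :: N) = dist₁ s.1 s.2 + Network.length N := by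
      simp [Network.length]
    rw [h1, h2, ENNReal.ofReal_add (dist₁_nonneg _ _) h0]
    refine (measure_union_le _ _).trans (add_le_add ?_ (ih fun s hs => hN s (.tail _ hs)))
    rw [hausdorffMeasure_segment, edist_eq_of_axisParallel (hN s List.mem_cons_self)]

end tours

/-! ### Nearest insertion -/

section prim

variable {d : ℕ}

/-- The total length of a family of paths, each hanging from a root. -/
noncomputable def armsLength (B : List ((Fin d → ℝ) × List (Fin d → ℝ))) : ℝ :=
  (B.map fun b => plen (b.1 :: b.2)).sum

/-- `PrimCost V U r`: adding the points of `U` to those of `V` one by one, always the one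
nearest to the points present, costs `r`. -/
inductive PrimCost : List (Fin d → ℝ) → List (Fin d → ℝ) → ℝ → Prop
  | nil (V) : PrimCost V [] 0
  | cons {V U V' U' : List (Fin d → ℝ)} {u : Fin d → ℝ} {D r : ℝ} :
      U.Perm (u :: U') → V'.Perm (u :: V) → (∀ x ∈ U, ∀ v ∈ V, D ≤ dist₁ x v) →
      PrimCost V' U' r → PrimCost V U (D + r)

/-- The missing points are spread over arms rooted at present points. When `u` is added, its arm
loses its first edge, which joins `V` to `U` and so has length at least `D`; the rest splits at `u`
into two arms rooted at `u`. Thus the arms pay for every insertion. -/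
theorem PrimCost.le_armsLength {V U : List (Fin d → ℝ)} {r : ℝ} (h : PrimCost V U r)
    (B : List ((Fin d → ℝ) × List (Fin d → ℝ))) (hV : ∀ b ∈ B, b.1 ∈ V)
    (hU : (B.flatMap Prod.snd).Perm U) : r ≤ armsLength B := by
  induction h generalizing B with
  | nil V =>
    refine List.sum_nonneg ?_
    simp only [List.mem_map]
    rintro _ ⟨b, _, rfl⟩
    exact plen_nonneg _
  | @cons V U V' U' u D r hperm hV' hD _ ih =>
    have hu : u ∈ B.flatMap Prod.snd := hU.mem_iff.2 (hperm.mem_iff.2 List.mem_cons_self)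
    obtain ⟨⟨v, A⟩, hb, hA⟩ := List.mem_flatMap.1 hu
    obtain ⟨B₁, B₂, rfl⟩ := List.append_of_mem hb
    obtain ⟨A₁, A₂, rfl⟩ := List.append_of_mem hA
    have hv : v ∈ V := hV _ hb
    have key : D + plen (u :: A₁.reverse) + plen (u :: A₂) ≤ plen (v :: (A₁ ++ u :: A₂)) := by
      have hrev : plen (u :: A₁.reverse) = plen (A₁ ++ [u]) := by
        rw [← plen_reverse (A₁ ++ [u])]; simp
      have h1 : ∃ x ∈ U, plen (v :: (A₁ ++ u :: A₂)) = dist₁ v x + plen (A₁ ++ u :: A₂) := by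
        have hmem : ∀ x ∈ A₁ ++ u :: A₂, x ∈ U := fun x hx =>
          hU.mem_iff.1 (List.mem_flatMap.2 ⟨_, hb, hx⟩)
        cases A₁ with
        | nil => exact ⟨u, hmem u (by simp), rfl⟩
        | cons x A₁ => exact ⟨x, hmem x (by simp), rfl⟩
      obtain ⟨x, hx, h1⟩ := h1
      rw [h1, hrev, plen_append_cons u A₂ A₁, dist₁_comm]
      linarith [hD x hx v hv]
    have h2 := ih ((u, A₁.reverse) :: (u, A₂) :: (B₁ ++ B₂)) ?_ ?_
    · simp only [armsLength, List.map_cons, List.map_append, List.sum_cons,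
        List.sum_append] at h2 ⊢
      linarith
    · intro b hb
      rw [hV'.mem_iff]
      simp only [List.mem_cons, List.mem_append] at hb hV ⊢
      rcases hb with rfl | rfl | hb | hb
      exacts [Or.inl rfl, Or.inl rfl, Or.inr (hV b (Or.inl hb)),
        Or.inr (hV b (Or.inr (Or.inr hb)))]
    · have h3 := hU.trans hperm
      rw [← List.perm_cons u]
      refine List.Perm.trans ?_ h3
      simp only [List.flatMap_append, List.flatMap_cons]
      classical
      rw [List.perm_iff_count]
      intro x
      simp only [List.count_append, List.count_cons, List.count_reverse]
      omega

/-- Cutting the path at `v` yields two arms rooted at `v`. -/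
theorem PrimCost.le_plen {v : Fin d → ℝ} {U l : List (Fin d → ℝ)} {r : ℝ}
    (h : PrimCost [v] U r) (hl : l.Perm (v :: U)) : r ≤ plen l := by
  obtain ⟨A, B, rfl⟩ := List.append_of_mem (hl.mem_iff.2 List.mem_cons_self)
  refine (h.le_armsLength [(v, A.reverse), (v, B)] (by simp) ?_).trans_eq ?_
  · rw [← List.perm_cons v]
    refine List.Perm.trans ?_ hl
    classical
    rw [List.perm_iff_count]
    intro x
    simp only [List.flatMap_cons, List.flatMap_nil, List.count_append, List.count_cons,
      List.count_reverse, List.count_nil]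
    omega
  · have hrev : plen (v :: A.reverse) = plen (A ++ [v]) := by
      rw [← plen_reverse (A ++ [v])]; simp
    rw [plen_append_cons, ← hrev]
    simp [armsLength]

end prim

/-! ### Merging points pairwise towards a centre -/

section rounds

/-- The median of three numbers. -/
noncomputable def medR (x y z : ℝ) : ℝ :=
  if x ≤ y then (if z ≤ x then x else if z ≤ y then z else y)
  else (if z ≤ y then y else if z ≤ x then z else x)

theorem medR_mem (x y z : ℝ) : medR x y z ∈ Set.uIcc x y ∧ medR x y z ∈ Set.uIcc x z ∧
    medR x y z ∈ Set.uIcc y z := by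
  simp only [Set.mem_uIcc, medR]
  grind

variable {d : ℕ}

/-- The coordinatewise median of three points. -/
noncomputable def med (a b o : Fin d → ℝ) : Fin d → ℝ :=
  fun i => medR (a i) (b i) (o i)

theorem med_btw (a b o : Fin d → ℝ) : Btw a (med a b o) b := fun i =>
  (medR_mem (a i) (b i) (o i)).1

theorem med_btw_left (a b o : Fin d → ℝ) : Btw a (med a b o) o := fun i =>
  (medR_mem (a i) (b i) (o i)).2.1

theorem med_btw_right (a b o : Fin d → ℝ) : Btw b (med a b o) o := fun i =>
  (medR_mem (a i) (b i) (o i)).2.2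

/-- Consecutive points are merged in pairs. -/
noncomputable def roundPts (o : Fin d → ℝ) : List (Fin d → ℝ) → List (Fin d → ℝ)
  | [] => []
  | [a] => [a]
  | a :: b :: l => med a b o :: roundPts o l

/-- The segments that join the points to the points they are merged into. -/
noncomputable def roundSegs (o : Fin d → ℝ) : List (Fin d → ℝ) → Network d
  | [] => []
  | [_] => []
  | a :: b :: l => stair a (med a b o) ++ (stair b (med a b o) ++ roundSegs o l)

theorem length_roundPts (o : Fin d → ℝ) :
    ∀ l, (roundPts o l).length = (l.length + 1) / 2
  | [] => by simp [roundPts]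
  | [_] => by simp [roundPts]
  | a :: b :: l => by
    simp only [roundPts, List.length_cons, length_roundPts o l]
    omega

/-- The median lies on a shortest way from `a` to `b`, so visiting it instead of both is no detour.
The free starting point `x` makes the induction work. -/
theorem plen_cons_roundPts_le (o : Fin d → ℝ) :
    ∀ l x, plen (x :: roundPts o l) ≤ plen (x :: l)
  | [], x => le_rfl
  | [_], x => le_rfl
  | a :: b :: l, x => by
    simp only [roundPts, plen_cons_cons]
    linarith [plen_cons_roundPts_le o l (med a b o), plen_cons_le (med a b o) b l,
      dist₁_triangle x a (med a b o), (med_btw a b o).dist_add]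

theorem plen_roundPts_le (o : Fin d → ℝ) : ∀ l, plen (roundPts o l) ≤ plen l
  | [] => le_rfl
  | [_] => le_rfl
  | a :: b :: l => by
    simp only [roundPts, plen_cons_cons]
    linarith [plen_cons_roundPts_le o l (med a b o), plen_cons_le (med a b o) b l,
      dist₁_nonneg a (med a b o), (med_btw a b o).dist_add]

/-- The two staircases of a pair together have the length of the edge between its points, and a
round uses only every other edge of the path. -/
theorem length_roundSegs_le (o : Fin d → ℝ) : ∀ l, (roundSegs o l).length ≤ plen l
  | [] => le_rfl
  | [_] => le_rfl
  | a :: b :: l => by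
    simp only [roundSegs, plen_cons_cons, Network.length_append, stair_length]
    linarith [length_roundSegs_le o l, plen_tail_le b l, (med_btw a b o).dist_add,
      dist₁_comm b (med a b o)]

theorem roundSegs_isRectilinear (o : Fin d → ℝ) : ∀ l, (roundSegs o l).IsRectilinear
  | [] => by simp [roundSegs, Network.IsRectilinear]
  | [_] => by simp [roundSegs, Network.IsRectilinear]
  | _ :: _ :: l => (stair_isRectilinear _ _).append
      ((stair_isRectilinear _ _).append (roundSegs_isRectilinear o l))

theorem exists_roundPts (o : Fin d → ℝ) : ∀ l, ∀ a ∈ l,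
    ∃ m ∈ roundPts o l, Btw a m o ∧ (roundSegs o l).MConnects a m
  | [a], x, hx => by
    obtain rfl := List.mem_singleton.1 hx
    exact ⟨x, hx, .left _ _, .refl _ _⟩
  | a :: b :: l, x, hx => by
    rcases List.mem_cons.1 hx with rfl | hx
    · exact ⟨_, List.mem_cons_self, med_btw_left _ _ _,
        (stair_connects _ _).mono fun s hs => List.mem_append_left _ hs⟩
    rcases List.mem_cons.1 hx with rfl | hx
    · exact ⟨_, List.mem_cons_self, med_btw_right _ _ _, (stair_connects _ _).mono fun s hs =>
        List.mem_append_right _ (List.mem_append_left _ hs)⟩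
    · obtain ⟨m, hm, h1, h2⟩ := exists_roundPts o l x hx
      exact ⟨m, List.mem_cons_of_mem _ hm, h1, h2.mono fun s hs =>
        List.mem_append_right _ (List.mem_append_right _ hs)⟩

/-- `Rounds o l N`: the network `N` results from merging the points of `l` until at most one
point is left. -/
inductive Rounds (o : Fin d → ℝ) : List (Fin d → ℝ) → Network d → Prop
  | base {l} : l.length ≤ 1 → Rounds o l []
  | step {l N} : Rounds o (roundPts o l) N → Rounds o l (N ++ roundSegs o l)

variable {o : Fin d → ℝ} {l : List (Fin d → ℝ)} {N : Network d}

theorem Rounds.isRectilinear (h : Rounds o l N) : N.IsRectilinear := by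
  induction h with
  | base => simp [Network.IsRectilinear]
  | step _ ih => exact ih.append (roundSegs_isRectilinear _ _)

/-- Rounding up when halving preserves the bound `2 ^ k`, so `k` rounds suffice, each paid by a path
no longer than `l`. -/
theorem Rounds.length_le (h : Rounds o l N) {k : ℕ} (hk : l.length ≤ 2 ^ k) :
    N.length ≤ k * plen l := by
  induction h generalizing k with
  | base => exact mul_nonneg k.cast_nonneg (plen_nonneg _)
  | @step l N _ ih =>
    rw [Network.length_append]
    have h1 := length_roundSegs_le o l
    have h2 := plen_roundPts_le o l
    cases k with
    | zero =>
      -- The constructor `step` also applies to lists of at most one point; such rounds cost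
      -- nothing.
      have h3 : plen l = 0 := by
        match l, hk with
        | [], _ => rfl
        | [a], _ => rfl
      have h4 := ih (k := 0) (by rw [length_roundPts]; omega)
      simp only [Nat.cast_zero, zero_mul] at h4 ⊢
      linarith
    | succ k =>
      have h4 := ih (k := k) (by rw [length_roundPts]; rw [pow_succ] at hk; omega)
      have h5 := mul_le_mul_of_nonneg_left h2 (k.cast_nonneg (α := ℝ))
      push_cast
      linarith

/-- Each merge moves a point towards `o` in every coordinate, so consecutive pieces join to a
Manhattan path. -/
theorem Rounds.exists_center (h : Rounds o l N) :
    ∃ f, ∀ a ∈ l, Btw a f o ∧ N.MConnects a f := by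
  induction h with
  | @base l hl =>
    match l, hl with
    | [], _ => exact ⟨o, by simp⟩
    | [a], _ => exact ⟨a, by simpa using ⟨.left _ _, .refl _ _⟩⟩
  | @step l N h ih =>
    obtain ⟨f, hf⟩ := ih
    refine ⟨f, fun a ha => ?_⟩
    obtain ⟨m, hm, h1, h2⟩ := exists_roundPts o l a ha
    obtain ⟨h3, h4⟩ := hf m hm
    exact ⟨h1.trans_right h3, .trans (h1.inner h3)
      (h2.mono fun s hs => List.mem_append_right _ hs)
      (h4.mono fun s hs => List.mem_append_left _ hs)⟩

theorem Rounds.connects (h : Rounds o l N) {p q : Fin d → ℝ} (hp : p ∈ l) (hq : q ∈ l)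
    (ho : Btw p o q) : N.MConnects p q := by
  obtain ⟨f, hf⟩ := h.exists_center
  exact .trans (ho.of_common (hf p hp).1 (hf q hq).1) (hf p hp).2 (hf q hq).2.symm

end rounds

/-! ### The program -/

section program

open RealProg

/-- The concatenation of two lists. -/
def appendBody : Expr :=
  .split (.var 0)
    (.split (.var 0)
      (.pair (.var 0) (.call 0 (.pair (.var 1) (.var 3))))
      (.var 1))
    .nil

/-- The coordinate of a point with a given index. -/
def nthBody : Expr :=
  .split (.var 0)
    (.split (.var 0)
      (.ifLe (.var 3) (.lit 0)
        (.var 0)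
        (.call 1 (.pair (.var 1) (.sub (.var 3) (.lit 1)))))
      .nil)
    .nil

/-- The Manhattan distance of two points. -/
def distBody : Expr :=
  .split (.var 0)
    (.split (.var 0)
      (.split (.var 3)
        (.add (.ifLe (.var 2) (.var 0) (.sub (.var 0) (.var 2)) (.sub (.var 2) (.var 0)))
          (.call 2 (.pair (.var 3) (.var 1))))
        .nil)
      (.lit 0))
    .nil

/-- The coordinatewise median of three points. -/
def medBody : Expr :=
  .split (.var 0)
    (.split (.var 1)
      (.split (.var 2)
        (.split (.var 2)
          (.split (.var 5)
            (.pair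
              (.ifLe (.var 4) (.var 2)
                (.ifLe (.var 0) (.var 4) (.var 4) (.ifLe (.var 0) (.var 2) (.var 0) (.var 2)))
                (.ifLe (.var 0) (.var 2) (.var 2) (.ifLe (.var 0) (.var 4) (.var 0) (.var 4))))
              (.call 3 (.pair (.var 5) (.pair (.var 3) (.var 1)))))
            .nil)
          .nil)
        .nil)
      .nil)
    .nil

/-- A coordinate is put in front of the endpoints of all segments. -/
def mapConsBody : Expr :=
  .split (.var 0)
    (.split (.var 1)
      (.split (.var 0)
        (.pair (.pair (.pair (.var 4) (.var 0)) (.pair (.var 4) (.var 1)))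
          (.call 4 (.pair (.var 4) (.var 3))))
        .nil)
      .nil)
    .nil

/-- The staircase between two points. -/
def stairBody : Expr :=
  .split (.var 0)
    (.split (.var 0)
      (.split (.var 3)
        (.pair (.pair (.var 4) (.pair (.var 0) (.var 3)))
          (.call 4 (.pair (.var 0) (.call 5 (.pair (.var 3) (.var 1))))))
        .nil)
      .nil)
    .nil

/-- Consecutive points are merged in pairs; segments are added to an accumulator. -/
def roundBody : Expr :=
  .split (.var 0)
    (.split (.var 1)
      (.split (.var 2)
        (.split (.var 1)
          (.letIn (.call 3 (.pair (.var 2) (.pair (.var 0) (.var 4))))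
            (.split (.call 6 (.pair (.var 2) (.pair (.var 5) (.var 6))))
              (.pair (.pair (.var 2) (.var 0))
                (.call 0 (.pair (.call 5 (.pair (.var 5) (.var 2)))
                  (.call 0 (.pair (.call 5 (.pair (.var 3) (.var 2))) (.var 1))))))
              .nil))
          (.pair (.var 4) (.var 3)))
        (.pair .nil (.var 1)))
      .nil)
    .nil

/-- Points are merged until at most one is left. -/
def roundsBody : Expr :=
  .split (.var 0)
    (.split (.var 1)
      (.split (.var 2)
        (.split (.var 1)
          (.split (.call 6 (.pair (.var 6) (.pair (.var 4) (.var 5))))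
            (.call 7 (.pair (.var 0) (.pair (.var 6) (.var 1))))
            .nil)
          (.var 3))
        (.var 1))
      .nil)
    .nil

/-- The distance of a point to a nonempty list of points. -/
def minDistBody : Expr :=
  .split (.var 0)
    (.split (.var 1)
      (.split (.var 1)
        (.letIn (.call 2 (.pair (.var 4) (.var 2)))
          (.letIn (.call 8 (.pair (.var 5) (.var 4)))
            (.ifLe (.var 1) (.var 0) (.var 1) (.var 0))))
        (.call 2 (.pair (.var 2) (.var 0))))
      .nil)
    .nil

/-- A point is inserted after the first point of a list at most at a given distance. -/
def insertBody : Expr :=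
  .split (.var 0)
    (.split (.var 1)
      (.split (.var 1)
        (.ifLe (.call 2 (.pair (.var 4) (.var 0))) (.var 2)
          (.pair (.var 0) (.pair (.var 4) (.var 1)))
          (.pair (.var 0) (.call 9 (.pair (.var 4) (.pair (.var 2) (.var 1))))))
        .nil)
      .nil)
    .nil

/-- The point of a first list nearest to a second list, its distance, and the other points. -/
def extractBody : Expr :=
  .split (.var 0)
    (.split (.var 0)
      (.letIn (.call 8 (.pair (.var 0) (.var 3)))
        (.split (.call 10 (.pair (.var 2) (.var 4)))
          (.split (.var 1)
            (.ifLe (.var 4) (.var 0)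
              (.pair (.var 5) (.pair (.var 4) (.pair (.var 2) (.var 1))))
              (.pair (.var 2) (.pair (.var 0) (.pair (.var 5) (.var 1)))))
            .nil)
          (.pair (.var 1) (.pair (.var 0) .nil))))
      .nil)
    .nil

/-- Nearest insertion. -/
def primBody : Expr :=
  .split (.var 0)
    (.split (.call 10 (.pair (.var 1) (.var 0)))
      (.split (.var 1)
        (.call 11 (.pair (.call 9 (.pair (.var 2) (.pair (.var 0) (.var 4)))) (.var 1)))
        .nil)
      (.var 0))
    .nil

/-- The points with a coordinate less than a given number. -/
def filterLtBody : Expr :=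
  .split (.var 0)
    (.split (.var 1)
      (.split (.var 1)
        (.letIn (.call 12 (.pair (.var 4) (.pair (.var 2) (.var 1))))
          (.ifLe (.var 3) (.call 1 (.pair (.var 1) (.var 5)))
            (.var 0)
            (.pair (.var 1) (.var 0))))
        .nil)
      .nil)
    .nil

/-- The points with a coordinate greater than a given number. -/
def filterGtBody : Expr :=
  .split (.var 0)
    (.split (.var 1)
      (.split (.var 1)
        (.letIn (.call 13 (.pair (.var 4) (.pair (.var 2) (.var 1))))
          (.ifLe (.call 1 (.pair (.var 1) (.var 5))) (.var 3)
            (.var 0)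
            (.pair (.var 1) (.var 0))))
        .nil)
      .nil)
    .nil

/-- The length of a list. -/
def lenBody : Expr :=
  .split (.var 0) (.add (.lit 1) (.call 14 (.var 1))) (.lit 0)

/-- The first number among some coordinates of points that is a median. -/
def findMedBody : Expr :=
  .split (.var 0)
    (.split (.var 1)
      (.split (.var 1)
        (.letIn (.call 1 (.pair (.var 0) (.var 4)))
          -- The language has no multiplication; the count is doubled by adding it to itself.
          (.ifLe (.letIn (.call 14 (.call 12 (.pair (.var 5) (.pair (.var 0) (.var 3)))))
              (.add (.var 0) (.var 0)))
            (.call 14 (.var 3))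
            (.ifLe (.letIn (.call 14 (.call 13 (.pair (.var 5) (.pair (.var 0) (.var 3)))))
                (.add (.var 0) (.var 0)))
              (.call 14 (.var 3))
              (.var 0)
              (.call 15 (.pair (.var 5) (.pair (.var 3) (.var 2)))))
            (.call 15 (.pair (.var 5) (.pair (.var 3) (.var 2))))))
        (.lit 0))
      .nil)
    .nil

/-- The network for a list of points, by divide and conquer along the coordinates. -/
def netBody : Expr :=
  .split (.var 0)
    (.split (.var 0)
      (.split (.var 3)
        (.split (.var 3)
          (.ifLe (.var 4) (.lit 0)
            (.call 7 (.pair (.call 11 (.pair (.pair (.var 0) .nil) (.var 1)))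
              (.pair (.var 2) (.var 3))))
            (.letIn (.sub (.var 4) (.lit 1))
              (.letIn (.call 15 (.pair (.var 0) (.pair (.var 6) (.var 6))))
                -- Outer call: all points one level down, with the median put in front of the
                -- centre. Nested in its accumulator: the points below the median, then those above
                -- it, both at the same level.
                (.call 16 (.pair (.pair (.var 1) (.var 7)) (.pair (.pair (.var 0) (.var 4))
                  (.call 16 (.pair
                    (.pair (.var 6) (.call 12 (.pair (.var 1) (.pair (.var 0) (.var 7)))))
                    (.pair (.var 4)
                      (.call 16 (.pair
                        (.pair (.var 6) (.call 13 (.pair (.var 1) (.pair (.var 0) (.var 7)))))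
                        (.pair (.var 4) (.var 5)))))))))))))
          (.var 1))
        .nil)
      .nil)
    .nil

/-- The functions of the program. -/
def funs : List Expr :=
  [appendBody, nthBody, distBody, medBody, mapConsBody, stairBody, roundBody, roundsBody,
    minDistBody, insertBody, extractBody, primBody, filterLtBody, filterGtBody, lenBody,
    findMedBody, netBody]

/-- The program for dimension `d`. -/
def program (d : ℕ) : Program where
  funs := funs
  main := .call 16 (.pair (.pair (.lit d) (.var 0)) (.pair .nil .nil))

/-! ### Evaluation with bounded running time -/

/-- The expression evaluates to `v` in at most `k` steps. -/
def Runs (ρ : List Val) (e : Expr) (v : Val) (k : ℕ) : Prop :=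
  ∃ c ≤ k, Eval funs ρ e v c

namespace Runs

variable {ρ : List Val} {a b c e : Expr} {v w x y : Val} {k l m n : ℕ} {s t u : ℝ}

theorem mono (h : Runs ρ e v m) (hmn : m ≤ n) : Runs ρ e v n :=
  h.imp fun _ h => ⟨h.1.trans hmn, h.2⟩

theorem var {i : ℕ} (h : ρ[i]? = some v) : Runs ρ (.var i) v 1 := ⟨1, le_rfl, .var h⟩

theorem nil : Runs ρ .nil .nil 1 := ⟨1, le_rfl, .nil⟩

theorem lit {z : ℤ} (h : (z : ℝ) = s) : Runs ρ (.lit z) (.num s) 1 := ⟨1, le_rfl, h ▸ .lit⟩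

theorem pair : Runs ρ a x m → Runs ρ b y n → Runs ρ (.pair a b) (.pair x y) (m + n + 1) :=
  fun ⟨_, h1, h2⟩ ⟨_, h3, h4⟩ => ⟨_, by omega, .pair h2 h4⟩

theorem add : Runs ρ a (.num s) m → Runs ρ b (.num t) n → s + t = u →
    Runs ρ (.add a b) (.num u) (m + n + 1) :=
  fun ⟨_, h1, h2⟩ ⟨_, h3, h4⟩ h => by
    subst h; exact ⟨_, by omega, .add h2 h4⟩

theorem sub : Runs ρ a (.num s) m → Runs ρ b (.num t) n → s - t = u →
    Runs ρ (.sub a b) (.num u) (m + n + 1) :=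
  fun ⟨_, h1, h2⟩ ⟨_, h3, h4⟩ h => by
    subst h; exact ⟨_, by omega, .sub h2 h4⟩

theorem letIn : Runs ρ a x m → Runs (x :: ρ) b v n → Runs ρ (.letIn a b) v (m + n + 1) :=
  fun ⟨_, h1, h2⟩ ⟨_, h3, h4⟩ => ⟨_, by omega, .letIn h2 h4⟩

theorem split_pair : Runs ρ a (.pair x y) m → Runs (x :: y :: ρ) b v n →
    Runs ρ (.split a b c) v (m + n + 1) :=
  fun ⟨_, h1, h2⟩ ⟨_, h3, h4⟩ => ⟨_, by omega, .split_pair h2 h4⟩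

theorem split_nil : Runs ρ a .nil m → Runs ρ c v n → Runs ρ (.split a b c) v (m + n + 1) :=
  fun ⟨_, h1, h2⟩ ⟨_, h3, h4⟩ => ⟨_, by omega, .split_atom h2 (fun _ _ h => by cases h) h4⟩

theorem ifLe_true : Runs ρ a (.num s) k → Runs ρ b (.num t) m → s ≤ t → Runs ρ c v n →
    Runs ρ (.ifLe a b c e) v (k + m + n + 1) :=
  fun ⟨_, h1, h2⟩ ⟨_, h3, h4⟩ h ⟨_, h5, h6⟩ => ⟨_, by omega, .ifLe_true h2 h4 h h6⟩

theorem ifLe_false : Runs ρ a (.num s) k → Runs ρ b (.num t) m → ¬ s ≤ t → Runs ρ e v n →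
    Runs ρ (.ifLe a b c e) v (k + m + n + 1) :=
  fun ⟨_, h1, h2⟩ ⟨_, h3, h4⟩ h ⟨_, h5, h6⟩ => ⟨_, by omega, .ifLe_false h2 h4 h h6⟩

theorem ifLe : Runs ρ a (.num s) k → Runs ρ b (.num t) l → Runs ρ c v m → Runs ρ e w n →
    Runs ρ (.ifLe a b c e) (if s ≤ t then v else w) (k + l + max m n + 1) := by
  intro h1 h2 h3 h4
  split_ifs with h
  · exact (h1.ifLe_true h2 h h3).mono (by omega)
  · exact (h1.ifLe_false h2 h h4).mono (by omega)

theorem call {f : ℕ} {body : Expr} (hf : funs[f]? = some body) :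
    Runs ρ a x m → Runs [x] body v n → Runs ρ (.call f a) v (m + n + 1) :=
  fun ⟨_, h1, h2⟩ ⟨_, h3, h4⟩ => ⟨_, by omega, .call hf h2 h4⟩

end Runs

/-! ### Running times of the functions for points -/

theorem encodePoint_succ {d : ℕ} (p : Fin (d + 1) → ℝ) :
    encodePoint p = .pair (.num (p 0)) (encodePoint (Fin.tail p)) := by
  simp [encodePoint, encodeList, List.ofFn_succ, Fin.tail]

/-- A list of points as a value. -/
def encodePoints {d : ℕ} (l : List (Fin d → ℝ)) : Val :=
  encodeList (l.map encodePoint)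

theorem runs_append (l l' : List Val) :
    Runs [.pair (encodeList l) (encodeList l')] appendBody (encodeList (l ++ l'))
      (12 * (l.length + 1)) := by
  induction l with
  | nil => exact (Runs.split_pair (.var rfl) (.split_nil (.var rfl) (.var rfl))).mono (by simp)
  | cons x l ih =>
    exact (Runs.split_pair (.var rfl) (.split_pair (.var rfl) (.pair (.var rfl)
      (.call rfl (.pair (.var rfl) (.var rfl)) ih)))).mono
      (by simp only [List.length_cons]; omega)

theorem runs_nth {d : ℕ} (p : Fin d → ℝ) (i : Fin d) :
    Runs [.pair (encodePoint p) (.num ((i : ℕ) : ℝ))] nthBody (.num (p i)) (20 * d) := by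
  induction d with
  | zero => exact i.elim0
  | succ d ih =>
    rw [encodePoint_succ]
    refine Fin.cases ?_ (fun i => ?_) i
    · exact (Runs.split_pair (.var rfl) (.split_pair (.var rfl) (.ifLe_true (.var rfl)
        (.lit rfl) (by simp) (.var rfl)))).mono (by omega)
    · refine (Runs.split_pair (.var rfl) (.split_pair (.var rfl) (.ifLe_false (.var rfl)
        (.lit rfl) ?_ (.call rfl (.pair (.var rfl) (.sub (.var rfl) (.lit rfl) ?_))
          (ih (Fin.tail p) i))))).mono (by omega)
      · rw [not_le]; simp; positivity
      · simp

theorem runs_dist {d : ℕ} (p q : Fin d → ℝ) :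
    Runs [.pair (encodePoint p) (encodePoint q)] distBody (.num (dist₁ p q))
      (30 * (d + 1)) := by
  induction d with
  | zero =>
    exact (Runs.split_pair (.var rfl) (.split_nil (.var rfl) (.lit (by simp [dist₁])))).mono
      (by omega)
  | succ d ih =>
    rw [encodePoint_succ p, encodePoint_succ q]
    have h : Runs [.num (q 0), encodePoint (Fin.tail q), .num (p 0), encodePoint (Fin.tail p),
        .pair (.num (p 0)) (encodePoint (Fin.tail p)),
        .pair (.num (q 0)) (encodePoint (Fin.tail q)),
        .pair (.pair (.num (p 0)) (encodePoint (Fin.tail p)))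
          (.pair (.num (q 0)) (encodePoint (Fin.tail q)))]
        (.ifLe (.var 2) (.var 0) (.sub (.var 0) (.var 2)) (.sub (.var 2) (.var 0)))
        (.num |p 0 - q 0|) 6 := by
      rcases le_or_gt (p 0) (q 0) with h | h
      · exact Runs.ifLe_true (.var rfl) (.var rfl) h (.sub (.var rfl) (.var rfl)
          (by rw [abs_of_nonpos (by linarith)]; ring))
      · exact Runs.ifLe_false (.var rfl) (.var rfl) (not_le.2 h) (.sub (.var rfl) (.var rfl)
          (by rw [abs_of_nonneg (by linarith)]))
    refine (Runs.split_pair (.var rfl) (.split_pair (.var rfl) (.split_pair (.var rfl)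
      (.add h (.call rfl (.pair (.var rfl) (.var rfl)) (ih (Fin.tail p) (Fin.tail q)))
        ?_)))).mono (by omega)
    simp only [dist₁, Fin.sum_univ_succ, Fin.tail]

theorem runs_med {d : ℕ} (a b o : Fin d → ℝ) :
    Runs [.pair (encodePoint a) (.pair (encodePoint b) (encodePoint o))] medBody
      (encodePoint (med a b o)) (40 * (d + 1)) := by
  induction d with
  | zero =>
    exact (Runs.split_pair (.var rfl) (.split_pair (.var rfl) (.split_nil (.var rfl)
      .nil))).mono (by omega)
  | succ d ih =>
    rw [encodePoint_succ a, encodePoint_succ b, encodePoint_succ o, encodePoint_succ (med a b o)]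
    refine (Runs.split_pair (.var rfl) (.split_pair (.var rfl) (.split_pair (.var rfl)
      (.split_pair (.var rfl) (.split_pair (.var rfl) (.pair (m := 15) ?_ (.call rfl (.pair
        (.var rfl) (.pair (.var rfl) (.var rfl)))
          (ih (Fin.tail a) (Fin.tail b) (Fin.tail o))))))))).mono (by omega)
    simp only [med, medR, apply_ite Val.num]
    exact (Runs.ifLe (.var rfl) (.var rfl)
      (.ifLe (.var rfl) (.var rfl) (.var rfl) (.ifLe (.var rfl) (.var rfl) (.var rfl) (.var rfl)))
      (.ifLe (.var rfl) (.var rfl) (.var rfl)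
        (.ifLe (.var rfl) (.var rfl) (.var rfl) (.var rfl)))).mono (by simp)

theorem runs_mapCons {d : ℕ} (y : ℝ) (N : Network d) :
    Runs [.pair (.num y) (encodeNetwork N)] mapConsBody
      (encodeNetwork (N.map fun s => ((Fin.cons y s.1 : Fin (d + 1) → ℝ),
        (Fin.cons y s.2 : Fin (d + 1) → ℝ)))) (20 * (List.length N + 1)) := by
  induction N with
  | nil => exact (Runs.split_pair (.var rfl) (.split_nil (.var rfl) .nil)).mono (by simp)
  | cons s N ih =>
    have h : encodeNetwork ((s :: N).map fun s => ((Fin.cons y s.1 : Fin (d + 1) → ℝ),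
        (Fin.cons y s.2 : Fin (d + 1) → ℝ))) =
        .pair (.pair (.pair (.num y) (encodePoint s.1)) (.pair (.num y) (encodePoint s.2)))
          (encodeNetwork (N.map fun s => ((Fin.cons y s.1 : Fin (d + 1) → ℝ),
            (Fin.cons y s.2 : Fin (d + 1) → ℝ)))) := by
      simp only [List.map_cons, encodeNetwork, encodeList, encodePoint_succ, Fin.cons_zero,
        Fin.tail_cons]
    rw [h]
    exact (Runs.split_pair (.var rfl) (.split_pair (.var rfl)
      (.split_pair (.var rfl) (.pair (.pair (.pair (.var rfl) (.var rfl))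
        (.pair (.var rfl) (.var rfl)))
        (.call rfl (.pair (.var rfl) (.var rfl)) ih))))).mono
      (by simp only [List.length_cons]; omega)

/-- Quadratic in the dimension, since each recursion step rewrites all segments of the
lower-dimensional staircase. -/
theorem runs_stair {d : ℕ} (a b : Fin d → ℝ) :
    Runs [.pair (encodePoint a) (encodePoint b)] stairBody (encodeNetwork (stair a b))
      (50 * (d + 1) ^ 2) := by
  induction d with
  | zero =>
    exact (Runs.split_pair (.var rfl) (.split_nil (.var rfl) .nil)).mono (by omega)
  | succ d ih =>
    have h : encodeNetwork (stair a b) = .pair (.pair (encodePoint a)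
        (.pair (.num (b 0)) (encodePoint (Fin.tail a))))
        (encodeNetwork ((stair (Fin.tail a) (Fin.tail b)).map fun s =>
          ((Fin.cons (b 0) s.1 : Fin (d + 1) → ℝ), (Fin.cons (b 0) s.2 : Fin (d + 1) → ℝ)))) := by
      rw [stair_succ]
      simp only [encodeNetwork, List.map_cons, encodeList]
      rw [encodePoint_succ (Fin.cons (b 0) (Fin.tail a)), Fin.cons_zero, Fin.tail_cons]
    have hlen : List.length (stair (Fin.tail a) (Fin.tail b)) = d := by simp [stair]
    have hcons := runs_mapCons (b 0) (stair (Fin.tail a) (Fin.tail b))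
    rw [hlen] at hcons
    rw [h, encodePoint_succ a, encodePoint_succ b]
    exact (Runs.split_pair (.var rfl) (.split_pair (.var rfl) (.split_pair (.var rfl)
      (.pair (.pair (.var rfl) (.pair (.var rfl) (.var rfl)))
        (.call rfl (.pair (.var rfl) (.call rfl (.pair (.var rfl) (.var rfl))
          (ih (Fin.tail a) (Fin.tail b)))) hcons))))).mono (by ring_nf; omega)

end program

section subroutines

open RealProg

variable {d : ℕ}

/-! ### Subroutines on lists of points -/

theorem runs_append_network (N N' : Network d) :
    Runs [.pair (encodeNetwork N) (encodeNetwork N')] appendBody (encodeNetwork (N ++ N'))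
      (12 * (List.length N + 1)) := by
  simpa [encodeNetwork] using runs_append (N.map fun s => .pair (encodePoint s.1)
    (encodePoint s.2)) (N'.map fun s => .pair (encodePoint s.1) (encodePoint s.2))

theorem runs_append_stair (a b : Fin d → ℝ) (N : Network d) :
    Runs [.pair (encodeNetwork (stair a b)) (encodeNetwork N)] appendBody
      (encodeNetwork (stair a b ++ N)) (12 * (d + 1)) := by
  simpa [stair] using runs_append_network (stair a b) N

/-- Each pair pays for one median, two staircases and two concatenations; the left operand of a
concatenation has only `d` segments. -/
theorem runs_round (o : Fin d → ℝ) (acc : Network d) : ∀ l : List (Fin d → ℝ),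
    Runs [.pair (encodePoints l) (.pair (encodePoint o) (encodeNetwork acc))] roundBody
      (.pair (encodePoints (roundPts o l)) (encodeNetwork (roundSegs o l ++ acc)))
      (300 * (d + 1) ^ 2 * (l.length + 1))
  | [] => (Runs.split_pair (.var rfl) (.split_pair (.var rfl) (.split_nil (.var rfl)
      (.pair .nil (.var rfl))))).mono (by simp; ring_nf; omega)
  | [a] => (Runs.split_pair (.var rfl) (.split_pair (.var rfl) (.split_pair (.var rfl)
      (.split_nil (.var rfl) (.pair (.var rfl) (.var rfl)))))).mono (by simp; ring_nf; omega)
  | a :: b :: l => by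
    simp only [roundPts, roundSegs, List.append_assoc]
    exact (Runs.split_pair (.var rfl) (.split_pair (.var rfl) (.split_pair (.var rfl)
      (.split_pair (.var rfl) (.letIn
        (.call rfl (.pair (.var rfl) (.pair (.var rfl) (.var rfl))) (runs_med a b o))
        (.split_pair
          (.call rfl (.pair (.var rfl) (.pair (.var rfl) (.var rfl))) (runs_round o acc l))
          (.pair (.pair (.var rfl) (.var rfl))
            (.call rfl (.pair
              (.call rfl (.pair (.var rfl) (.var rfl)) (runs_stair a (med a b o)))
              (.call rfl (.pair
                (.call rfl (.pair (.var rfl) (.var rfl)) (runs_stair b (med a b o)))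
                (.var rfl)) (runs_append_stair _ _ _)))
              (runs_append_stair _ _ _))))))))).mono
      (by simp only [List.length_cons]; ring_nf; omega)

/-- A crude count of one round per point suffices, since a list of at least two points gets strictly
shorter. -/
theorem runs_rounds (o : Fin d → ℝ) (n : ℕ) (l : List (Fin d → ℝ)) (hl : l.length ≤ n)
    (acc : Network d) : ∃ N, Rounds o l N ∧
    Runs [.pair (encodePoints l) (.pair (encodePoint o) (encodeNetwork acc))] roundsBody
      (encodeNetwork (N ++ acc)) ((l.length + 1) * (300 * (d + 1) ^ 2 * (n + 1) + 30)) := by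
  induction h : l.length using Nat.strong_induction_on generalizing l acc with
  | _ k ih =>
  match l with
  | [] => exact ⟨[], .base (by simp), (Runs.split_pair (.var rfl) (.split_pair (.var rfl)
      (.split_nil (.var rfl) (.var rfl)))).mono (by ring_nf; omega)⟩
  | [a] => exact ⟨[], .base (by simp), (Runs.split_pair (.var rfl) (.split_pair (.var rfl)
      (.split_pair (.var rfl) (.split_nil (.var rfl) (.var rfl))))).mono (by ring_nf; omega)⟩
  | a :: b :: l =>
    have hlen := length_roundPts o (a :: b :: l)
    simp only [List.length_cons] at h hl hlen
    obtain ⟨N, hN, hrun⟩ := ih _ (by omega) (roundPts o (a :: b :: l)) (by omega)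
      (roundSegs o (a :: b :: l) ++ acc) rfl
    refine ⟨N ++ roundSegs o (a :: b :: l), .step hN, ?_⟩
    rw [List.append_assoc]
    have hr := (runs_round o acc (a :: b :: l)).mono (n := 300 * (d + 1) ^ 2 * (n + 1))
      (Nat.mul_le_mul_left _ (by simpa using hl))
    refine (Runs.split_pair (.var rfl) (.split_pair (.var rfl) (.split_pair (.var rfl)
      (.split_pair (.var rfl) (.split_pair
        (.call rfl (.pair (.var rfl) (.pair (.var rfl) (.var rfl))) hr)
        (.call rfl (.pair (.var rfl) (.pair (.var rfl) (.var rfl))) hrun)))))).mono ?_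
    generalize 300 * (d + 1) ^ 2 * (n + 1) = B
    have : ((roundPts o (a :: b :: l)).length + 1) * (B + 30) ≤ k * (B + 30) :=
      Nat.mul_le_mul_right _ (by omega)
    rw [add_mul k]
    omega

/-- The distance of a point to a list of points. -/
noncomputable def minDist (u : Fin d → ℝ) : List (Fin d → ℝ) → ℝ
  -- A default value; the running-time lemmas only concern nonempty lists.
  | [] => 0
  | [v] => dist₁ u v
  | v :: w :: l => if dist₁ u v ≤ minDist u (w :: l) then dist₁ u v else minDist u (w :: l)

theorem minDist_le (u : Fin d → ℝ) : ∀ V : List (Fin d → ℝ), ∀ v ∈ V, minDist u V ≤ dist₁ u v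
  | [w], v, hv => by rw [List.mem_singleton.1 hv]; exact le_rfl
  | w :: w' :: l, v, hv => by
    have ih := minDist_le u (w' :: l)
    simp only [minDist]
    rcases List.mem_cons.1 hv with rfl | hv
    · split_ifs <;> linarith
    · have := ih v hv
      split_ifs <;> linarith

theorem exists_minDist (u : Fin d → ℝ) : ∀ V : List (Fin d → ℝ), V ≠ [] →
    ∃ v ∈ V, dist₁ u v = minDist u V
  | [w], _ => ⟨w, by simp, rfl⟩
  | w :: w' :: l, _ => by
    obtain ⟨v, hv, h⟩ := exists_minDist u (w' :: l) (by simp)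
    simp only [minDist]
    split_ifs
    · exact ⟨w, by simp, rfl⟩
    · exact ⟨v, List.mem_cons_of_mem _ hv, h⟩

theorem runs_minDist (u : Fin d → ℝ) : ∀ V : List (Fin d → ℝ), V ≠ [] →
    Runs [.pair (encodePoint u) (encodePoints V)] minDistBody (.num (minDist u V))
      (60 * (d + 1) * (V.length + 1))
  | [v], _ => (Runs.split_pair (.var rfl) (.split_pair (.var rfl) (.split_nil (.var rfl)
      (.call rfl (.pair (.var rfl) (.var rfl)) (runs_dist u v))))).mono (by simp; ring_nf; omega)
  | v :: w :: l, _ => by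
    simp only [minDist, apply_ite Val.num]
    exact (Runs.split_pair (.var rfl) (.split_pair (.var rfl) (.split_pair (.var rfl)
      (.letIn (.call rfl (.pair (.var rfl) (.var rfl)) (runs_dist u v))
        (.letIn (.call rfl (.pair (.var rfl) (.var rfl)) (runs_minDist u (w :: l) (by simp)))
          (.ifLe (.var rfl) (.var rfl) (.var rfl) (.var rfl))))))).mono
      (by simp only [List.length_cons]; ring_nf; omega)

/-- A point is inserted after the first point at distance at most `D`. -/
noncomputable def insertAfter (u : Fin d → ℝ) (D : ℝ) : List (Fin d → ℝ) → List (Fin d → ℝ)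
  | [] => []
  | v :: l => if dist₁ u v ≤ D then v :: u :: l else v :: insertAfter u D l

theorem insertAfter_eq (u : Fin d → ℝ) (D : ℝ) : ∀ V : List (Fin d → ℝ),
    (∃ v ∈ V, dist₁ u v ≤ D) → ∃ l v l', V = l ++ v :: l' ∧ dist₁ u v ≤ D ∧
      insertAfter u D V = l ++ v :: u :: l'
  | [], h => by simp at h
  | w :: V, h => by
    by_cases hw : dist₁ u w ≤ D
    · exact ⟨[], w, V, rfl, hw, by simp [insertAfter, hw]⟩
    · obtain ⟨l, v, l', h1, h2, h3⟩ := insertAfter_eq u D V (by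
        obtain ⟨v, hv, h⟩ := h
        rcases List.mem_cons.1 hv with rfl | hv
        exacts [absurd h hw, ⟨v, hv, h⟩])
      exact ⟨w :: l, v, l', by simp [h1], h2, by simp [insertAfter, hw, h3]⟩

theorem runs_insert (u : Fin d → ℝ) (D : ℝ) : ∀ V : List (Fin d → ℝ),
    Runs [.pair (encodePoint u) (.pair (.num D) (encodePoints V))] insertBody
      (encodePoints (insertAfter u D V)) (60 * (d + 1) * (V.length + 1))
  | [] => (Runs.split_pair (.var rfl) (.split_pair (.var rfl) (.split_nil (.var rfl)
      .nil))).mono (by simp; ring_nf; omega)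
  | v :: V => by
    simp only [insertAfter, apply_ite encodePoints]
    exact (Runs.split_pair (.var rfl) (.split_pair (.var rfl) (.split_pair (.var rfl)
      (.ifLe (.call rfl (.pair (.var rfl) (.var rfl)) (runs_dist u v)) (.var rfl)
        (.pair (.var rfl) (.pair (.var rfl) (.var rfl)))
        (.pair (.var rfl) (.call rfl (.pair (.var rfl) (.pair (.var rfl) (.var rfl)))
          (runs_insert u D V))))))).mono
      (by simp only [List.length_cons]; ring_nf; omega)

/-- The point of a list nearest to the list `V`, its distance and the other points. -/
noncomputable def extract (V : List (Fin d → ℝ)) :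
    List (Fin d → ℝ) → Option ((Fin d → ℝ) × ℝ × List (Fin d → ℝ))
  | [] => none
  | u :: U =>
    match extract V U with
    | none => some (u, minDist u V, [])
    | some (b, E, R) =>
      if minDist u V ≤ E then some (u, minDist u V, b :: R) else some (b, E, u :: R)

/-- The result of `extract` as a value. -/
def encodeExtract : Option ((Fin d → ℝ) × ℝ × List (Fin d → ℝ)) → Val
  | none => .nil
  | some (b, E, R) => .pair (encodePoint b) (.pair (.num E) (encodePoints R))

theorem extract_spec (V : List (Fin d → ℝ)) : ∀ U, match extract V U with
    | none => U = []
    | some (b, E, R) => U.Perm (b :: R) ∧ E = minDist b V ∧ ∀ x ∈ U, E ≤ minDist x V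
  | [] => rfl
  | u :: U => by
    have ih := extract_spec V U
    rcases h : extract V U with _ | ⟨b, E, R⟩
    · rw [h] at ih
      obtain rfl : U = [] := ih
      simp [extract]
    · rw [h] at ih
      obtain ⟨h1, h2, h3⟩ := ih
      simp only [extract, h]
      by_cases hle : minDist u V ≤ E
      · rw [if_pos hle]
        refine ⟨h1.cons u, rfl, ?_⟩
        intro x hx
        rcases List.mem_cons.1 hx with rfl | hx
        exacts [le_rfl, hle.trans (h3 x hx)]
      · rw [if_neg hle]
        refine ⟨(h1.cons u).trans (.swap _ _ _), h2, ?_⟩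
        intro x hx
        rcases List.mem_cons.1 hx with rfl | hx
        exacts [(not_le.1 hle).le, h3 x hx]

theorem runs_extract (V : List (Fin d → ℝ)) (hV : V ≠ []) : ∀ U : List (Fin d → ℝ),
    Runs [.pair (encodePoints U) (encodePoints V)] extractBody (encodeExtract (extract V U))
      ((U.length + 1) * (60 * (d + 1) * (V.length + 1) + 40))
  | [] => (Runs.split_pair (.var rfl) (.split_nil (.var rfl) .nil)).mono (by simp)
  | u :: U => by
    have ih := runs_extract V hV U
    have hd := runs_minDist u V hV
    simp only [extract, List.length_cons]
    generalize 60 * (d + 1) * (V.length + 1) = B at *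
    split
    · next h =>
      rw [h] at ih
      exact (Runs.split_pair (.var rfl) (.split_pair (.var rfl)
        (.letIn (.call rfl (.pair (.var rfl) (.var rfl)) hd)
          (.split_nil (.call rfl (.pair (.var rfl) (.var rfl)) ih)
            (.pair (.var rfl) (.pair (.var rfl) .nil)))))).mono
        (by rw [add_mul (U.length + 1)]; omega)
    · next b E R h =>
      rw [h] at ih
      simp only [apply_ite encodeExtract]
      exact (Runs.split_pair (.var rfl) (.split_pair (.var rfl)
        (.letIn (.call rfl (.pair (.var rfl) (.var rfl)) hd)
          (.split_pair (.call rfl (.pair (.var rfl) (.var rfl)) ih)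
            (.split_pair (.var rfl) (.ifLe (.var rfl) (.var rfl)
              (.pair (.var rfl) (.pair (.var rfl) (.pair (.var rfl) (.var rfl))))
              (.pair (.var rfl) (.pair (.var rfl) (.pair (.var rfl) (.var rfl)))))))))).mono
        (by rw [add_mul (U.length + 1)]; omega)

/-- Inserting `u` right after a point at distance at most `D` lengthens the path by at most `2 * D`,
twice the charge recorded by `PrimCost`. -/
theorem runs_prim (n : ℕ) : ∀ (k : ℕ) (V U : List (Fin d → ℝ)), U.length = k → V ≠ [] →
    V.length + U.length ≤ n → ∃ l r, PrimCost V U r ∧ l.Perm (V ++ U) ∧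
      plen l ≤ plen V + 2 * r ∧
      Runs [.pair (encodePoints V) (encodePoints U)] primBody (encodePoints l)
        ((k + 1) * ((n + 1) * (60 * (d + 1) * (n + 1) + 40) + 60 * (d + 1) * (n + 1) + 40))
  | 0, V, U, hU, hV, hn => by
    obtain rfl := List.length_eq_zero_iff.1 hU
    refine ⟨V, 0, .nil V, by simp, by simp, ?_⟩
    have hx := runs_extract V hV []
    have hB : (0 + 1) * (60 * (d + 1) * (V.length + 1) + 40) ≤
        (n + 1) * (60 * (d + 1) * (n + 1) + 40) := by gcongr <;> simp at hn <;> omega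
    exact (Runs.split_pair (.var rfl) (.split_nil (.call rfl (.pair (.var rfl) (.var rfl))
      (hx.mono hB)) (.var rfl))).mono (by omega)
  | k + 1, V, U, hU, hV, hn => by
    have hs := extract_spec V U
    have hx := runs_extract V hV U
    split at hs
    · subst hs; simp at hU
    next u D U' h =>
    obtain ⟨hperm, hD, hmin⟩ := hs
    rw [h] at hx
    obtain ⟨v, hv, hvD⟩ := exists_minDist u V hV
    obtain ⟨l₁, w, l₂, h1, h2, h3⟩ := insertAfter_eq u D V ⟨v, hv, by rw [hvD, hD]⟩
    have hi := runs_insert u D V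
    have hperm' : (insertAfter u D V).Perm (u :: V) := by
      rw [h1] at h3 ⊢
      rw [h3]
      classical
      rw [List.perm_iff_count]
      intro x
      simp only [List.count_append, List.count_cons]
      omega
    have hlen := hperm.length_eq
    have hlen' := hperm'.length_eq
    rw [List.length_cons] at hlen hlen'
    obtain ⟨l, r, hl1, hl2, hl3, hl4⟩ := runs_prim n k (insertAfter u D V) U' (by omega)
      (by rw [h3]; simp) (by omega)
    refine ⟨l, D + r, .cons hperm hperm' (fun x hx v hv => (hmin x hx).trans
      (minDist_le x V v hv)) hl1, ?_, ?_, ?_⟩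
    · refine hl2.trans ((hperm'.append_right U').trans ?_)
      exact (List.perm_middle.symm).trans (hperm.symm.append_left V)
    · have := plen_insert_le l₁ w u l₂
      rw [← h1, ← h3] at this
      linarith
    · have hB1 : (U.length + 1) * (60 * (d + 1) * (V.length + 1) + 40) ≤
          (n + 1) * (60 * (d + 1) * (n + 1) + 40) := by gcongr <;> omega
      have hB2 : 60 * (d + 1) * (V.length + 1) ≤ 60 * (d + 1) * (n + 1) := by gcongr; omega
      refine (Runs.split_pair (.var rfl) (.split_pair
        (.call rfl (.pair (.var rfl) (.var rfl)) (hx.mono hB1))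
        (.split_pair (.var rfl) (.call rfl (.pair
          (.call rfl (.pair (.var rfl) (.pair (.var rfl) (.var rfl))) (hi.mono hB2))
          (.var rfl)) hl4)))).mono ?_
      rw [add_mul (k + 1)]
      omega

end subroutines

section net

open RealProg MeasureTheory Measure

variable {d : ℕ}

/-! ### Medians -/

/-- The points of a list with coordinate `i` less than `c`. -/
noncomputable def filterLt (i : Fin d) (c : ℝ) (S : List (Fin d → ℝ)) : List (Fin d → ℝ) :=
  S.filter fun p => p i < c

/-- The points of a list with coordinate `i` greater than `c`. -/
noncomputable def filterGt (i : Fin d) (c : ℝ) (S : List (Fin d → ℝ)) : List (Fin d → ℝ) :=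
  S.filter fun p => c < p i

theorem runs_filterLt (i : Fin d) (c : ℝ) : ∀ S : List (Fin d → ℝ),
    Runs [.pair (.num ((i : ℕ) : ℝ)) (.pair (.num c) (encodePoints S))] filterLtBody
      (encodePoints (filterLt i c S)) (50 * (d + 1) * (S.length + 1))
  | [] => (Runs.split_pair (.var rfl) (.split_pair (.var rfl) (.split_nil (.var rfl)
      .nil))).mono (by simp; ring_nf; omega)
  | p :: S => by
    have h : filterLt i c (p :: S) = if c ≤ p i then filterLt i c S else p :: filterLt i c S := by
      split_ifs with h <;> simp [filterLt, h, not_le.1]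
    rw [h, apply_ite encodePoints]
    exact (Runs.split_pair (.var rfl) (.split_pair (.var rfl) (.split_pair (.var rfl)
      (.letIn (.call rfl (.pair (.var rfl) (.pair (.var rfl) (.var rfl))) (runs_filterLt i c S))
        (.ifLe (.var rfl) (.call rfl (.pair (.var rfl) (.var rfl)) (runs_nth p i)) (.var rfl)
          (.pair (.var rfl) (.var rfl))))))).mono
      (by simp only [List.length_cons]; ring_nf; omega)

theorem runs_filterGt (i : Fin d) (c : ℝ) : ∀ S : List (Fin d → ℝ),
    Runs [.pair (.num ((i : ℕ) : ℝ)) (.pair (.num c) (encodePoints S))] filterGtBody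
      (encodePoints (filterGt i c S)) (50 * (d + 1) * (S.length + 1))
  | [] => (Runs.split_pair (.var rfl) (.split_pair (.var rfl) (.split_nil (.var rfl)
      .nil))).mono (by simp; ring_nf; omega)
  | p :: S => by
    have h : filterGt i c (p :: S) = if p i ≤ c then filterGt i c S else p :: filterGt i c S := by
      split_ifs with h <;> simp [filterGt, h, not_le.1]
    rw [h, apply_ite encodePoints]
    exact (Runs.split_pair (.var rfl) (.split_pair (.var rfl) (.split_pair (.var rfl)
      (.letIn (.call rfl (.pair (.var rfl) (.pair (.var rfl) (.var rfl))) (runs_filterGt i c S))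
        (.ifLe (.call rfl (.pair (.var rfl) (.var rfl)) (runs_nth p i)) (.var rfl) (.var rfl)
          (.pair (.var rfl) (.var rfl))))))).mono
      (by simp only [List.length_cons]; ring_nf; omega)

theorem runs_len : ∀ l : List (Fin d → ℝ),
    Runs [encodePoints l] lenBody (.num (l.length : ℝ)) (10 * (l.length + 1))
  | [] => (Runs.split_nil (.var rfl) (.lit (by simp))).mono (by simp)
  | p :: l => (Runs.split_pair (.var rfl) (.add (.lit rfl) (.call rfl (.var rfl) (runs_len l))
      (by push_cast [List.length_cons]; ring))).mono (by simp only [List.length_cons]; omega)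

/-- At most half of the points lie on either side of the hyperplane `x i = c`. -/
def IsMedian (i : Fin d) (c : ℝ) (S : List (Fin d → ℝ)) : Prop :=
  2 * (filterLt i c S).length ≤ S.length ∧ 2 * (filterGt i c S).length ≤ S.length

/-- Take the smallest coordinate with at most half of the points above it. The next smaller one `q
i` has more than half above it, and all points below `p i` are at most `q i`, so fewer than half are
below `p i`. -/
theorem exists_isMedian (i : Fin d) {S : List (Fin d → ℝ)} (hS : S ≠ []) :
    ∃ p ∈ S, IsMedian i (p i) S := by
  classical
  set G := S.toFinset.filter fun p => 2 * (filterGt i (p i) S).length ≤ S.length with hG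
  have hne : G.Nonempty := by
    obtain ⟨m, hm, hmax⟩ := S.toFinset.exists_max_image (fun p => p i)
      (List.toFinset_nonempty_iff S |>.2 hS)
    refine ⟨m, Finset.mem_filter.2 ⟨hm, ?_⟩⟩
    have : filterGt i (m i) S = [] := by
      rw [filterGt, List.filter_eq_nil_iff]
      intro q hq
      simpa using hmax q (by simpa using hq)
    simp [this]
  obtain ⟨p, hp, hmin⟩ := G.exists_min_image (fun p => p i) hne
  rw [hG, Finset.mem_filter] at hp
  refine ⟨p, by simpa using hp.1, ?_, hp.2⟩
  rcases (filterLt i (p i) S).eq_nil_or_concat with h | ⟨_, _, h⟩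
  · simp [h]
  have hLne : (filterLt i (p i) S).toFinset.Nonempty := by
    rw [List.toFinset_nonempty_iff, h]; simp
  obtain ⟨q, hq, hqmax⟩ := Finset.exists_max_image _ (fun p => p i) hLne
  simp only [filterLt, List.mem_toFinset, List.mem_filter, decide_eq_true_eq] at hq hqmax
  have hqG : q ∉ G := fun hqG => absurd (hmin q hqG) (not_le.2 hq.2)
  rw [hG, Finset.mem_filter] at hqG
  have hq2 : S.length < 2 * (filterGt i (q i) S).length := by
    by_contra hc
    exact hqG ⟨by simpa using hq.1, not_lt.1 hc⟩
  have hsum := List.length_eq_countP_add_countP (l := S) (fun x => decide (q i < x i))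
  have hle : (filterLt i (p i) S).length ≤
      S.countP (fun x => decide ¬(decide (q i < x i)) = true) := by
    rw [filterLt, ← List.countP_eq_length_filter]
    refine List.countP_mono_left fun x hx hxp => ?_
    simpa using hqmax x ⟨hx, by simpa using hxp⟩
  rw [filterGt, ← List.countP_eq_length_filter] at hq2
  omega

/-- The candidates run through `R` while the counts always refer to the whole of `S`; quadratic
search is fast enough. -/
theorem runs_findMed (i : Fin d) (S : List (Fin d → ℝ)) : ∀ R : List (Fin d → ℝ),
    (∃ p ∈ R, IsMedian i (p i) S) → ∃ p ∈ R, IsMedian i (p i) S ∧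
      Runs [.pair (.num ((i : ℕ) : ℝ)) (.pair (encodePoints S) (encodePoints R))] findMedBody
        (.num (p i)) ((R.length + 1) * (300 * (d + 1) * (S.length + 1)))
  | [], h => by simp at h
  | p :: R, h => by
    have e1 : ((filterLt i (p i) S).length : ℝ) + (filterLt i (p i) S).length =
        ((2 * (filterLt i (p i) S).length : ℕ) : ℝ) := by push_cast; ring
    have e2 : ((filterGt i (p i) S).length : ℝ) + (filterGt i (p i) S).length =
        ((2 * (filterGt i (p i) S).length : ℕ) : ℝ) := by push_cast; ring
    have hlt := (runs_len (filterLt i (p i) S)).mono (n := 10 * (S.length + 1))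
      (by gcongr; exact List.length_filter_le _ _)
    have hgt := (runs_len (filterGt i (p i) S)).mono (n := 10 * (S.length + 1))
      (by gcongr; exact List.length_filter_le _ _)
    by_cases h1 : 2 * (filterLt i (p i) S).length ≤ S.length
    · by_cases h2 : 2 * (filterGt i (p i) S).length ≤ S.length
      · refine ⟨p, List.mem_cons_self, ⟨h1, h2⟩, ?_⟩
        exact (Runs.split_pair (.var rfl) (.split_pair (.var rfl) (.split_pair (.var rfl)
          (.letIn (.call rfl (.pair (.var rfl) (.var rfl)) (runs_nth p i))
            (.ifLe_true (.letIn (.call rfl (.call rfl (.pair (.var rfl) (.pair (.var rfl)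
                (.var rfl))) (runs_filterLt i (p i) S)) hlt) (.add (.var rfl) (.var rfl) e1))
              (.call rfl (.var rfl) (runs_len S)) (by exact_mod_cast h1)
              (.ifLe_true (.letIn (.call rfl (.call rfl (.pair (.var rfl) (.pair (.var rfl)
                  (.var rfl))) (runs_filterGt i (p i) S)) hgt) (.add (.var rfl) (.var rfl) e2))
                (.call rfl (.var rfl) (runs_len S)) (by exact_mod_cast h2)
                (.var rfl))))))).mono
          (by simp only [List.length_cons]; ring_nf; omega)
      · obtain ⟨q, hq, hm, hrun⟩ := runs_findMed i S R (by
          obtain ⟨q, hq, hm⟩ := h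
          rcases List.mem_cons.1 hq with rfl | hq
          exacts [absurd hm.2 h2, ⟨q, hq, hm⟩])
        refine ⟨q, List.mem_cons_of_mem _ hq, hm, ?_⟩
        exact (Runs.split_pair (.var rfl) (.split_pair (.var rfl) (.split_pair (.var rfl)
          (.letIn (.call rfl (.pair (.var rfl) (.var rfl)) (runs_nth p i))
            (.ifLe_true (.letIn (.call rfl (.call rfl (.pair (.var rfl) (.pair (.var rfl)
                (.var rfl))) (runs_filterLt i (p i) S)) hlt) (.add (.var rfl) (.var rfl) e1))
              (.call rfl (.var rfl) (runs_len S)) (by exact_mod_cast h1)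
              (.ifLe_false (.letIn (.call rfl (.call rfl (.pair (.var rfl) (.pair (.var rfl)
                  (.var rfl))) (runs_filterGt i (p i) S)) hgt) (.add (.var rfl) (.var rfl) e2))
                (.call rfl (.var rfl) (runs_len S)) (by exact_mod_cast h2)
                (.call rfl (.pair (.var rfl) (.pair (.var rfl) (.var rfl))) hrun))))))).mono
          (by simp only [List.length_cons]; ring_nf; omega)
    · obtain ⟨q, hq, hm, hrun⟩ := runs_findMed i S R (by
        obtain ⟨q, hq, hm⟩ := h
        rcases List.mem_cons.1 hq with rfl | hq
        exacts [absurd hm.1 h1, ⟨q, hq, hm⟩])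
      refine ⟨q, List.mem_cons_of_mem _ hq, hm, ?_⟩
      exact (Runs.split_pair (.var rfl) (.split_pair (.var rfl) (.split_pair (.var rfl)
        (.letIn (.call rfl (.pair (.var rfl) (.var rfl)) (runs_nth p i))
          (.ifLe_false (.letIn (.call rfl (.call rfl (.pair (.var rfl) (.pair (.var rfl)
              (.var rfl))) (runs_filterLt i (p i) S)) hlt) (.add (.var rfl) (.var rfl) e1))
            (.call rfl (.var rfl) (runs_len S)) (by exact_mod_cast h1)
            (.call rfl (.pair (.var rfl) (.pair (.var rfl) (.var rfl))) hrun)))))).mono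
        (by simp only [List.length_cons]; ring_nf; omega)

/-! ### Divide and conquer -/

/-- `R` contains the box spanned by any two of its points. -/
def BoxClosed (R : Set (Fin d → ℝ)) : Prop :=
  ∀ a ∈ R, ∀ b ∈ R, ∀ m, Btw a m b → m ∈ R

/-- The network `N` joins all pairs of points of `S` whose box, in the coordinates from `j` on,
contains `o`, and is not much longer than the part inside a box of any set `X` that joins all
points of `S`. -/
structure Good (j : ℕ) (S : List (Fin d → ℝ)) (o : Fin d → ℝ) (N : Network d) : Prop where
  rectilinear : N.IsRectilinear
  connects : ∀ p ∈ S, ∀ q ∈ S, (∀ i : Fin d, j ≤ i → o i ∈ Set.uIcc (p i) (q i)) →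
    N.MConnects p q
  -- Here `k` bounds the halvings at the current level and `h` those at lower levels. The
  -- restriction to `R` lets the bounds of separate halves add up.
  length_le : ∀ X R : Set (Fin d → ℝ), μH[1] X ≠ ⊤ → BoxClosed R → (∀ p ∈ S, p ∈ R) →
    (∀ p ∈ S, ∀ q ∈ S, RectPath X p q (dist₁ p q)) → ∀ h k : ℕ, k ≤ h → S.length < 2 ^ k →
    N.length ≤ 4 * h ^ j * k * (μH[1] : Measure (Fin d → ℝ)).real (X ∩ R)

theorem good_nil (j : ℕ) (o : Fin d → ℝ) : Good j [] o [] where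
  rectilinear := by simp [Network.IsRectilinear]
  connects := by simp
  length_le := by
    intros
    rw [Network.length_nil]
    positivity

/-- The factor 4 is 2 for the tour inside `X ∩ R` times 2 for nearest insertion; merging contributes
`k`. Manhattan paths stay in `R`, so `X ∩ R` still connects the points. -/
theorem good_zero {p : Fin d → ℝ} {S l : List (Fin d → ℝ)} {o : Fin d → ℝ} {N : Network d} {r : ℝ}
    (hS : (p :: S).Nodup) (hr : PrimCost [p] S r) (hl : l.Perm (p :: S)) (hlr : plen l ≤ 2 * r)
    (hN : Rounds o l N) : Good 0 (p :: S) o N where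
  rectilinear := hN.isRectilinear
  connects p hp q hq ho := hN.connects (hl.mem_iff.2 hp) (hl.mem_iff.2 hq) fun i => ho i i.1.zero_le
  length_le X R hX hR hSR hSX h k _ hk := by
    obtain ⟨l', hl', hlen⟩ := exists_perm_plen_le (W := X ∩ R)
      (ne_top_of_le_ne_top hX (measure_mono Set.inter_subset_left)) hS
      (fun p hp q hq => ⟨_, (hSX p hp q hq).inter hR le_rfl (hSR p hp) (hSR q hq)⟩)
    have h1 := hr.le_plen hl'
    have h2 := hN.length_le (k := k) (by rw [hl.length_eq]; exact hk.le)
    have h3 : plen l ≤ 4 * (μH[1] : Measure (Fin d → ℝ)).real (X ∩ R) := by linarith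
    have h4 := mul_le_mul_of_nonneg_left h3 (k.cast_nonneg (α := ℝ))
    rw [pow_zero]
    linarith

/-- With `ν` the measure of `X ∩ R`, the crossing pairs cost `4 * h ^ j * h * ν` and the two halves
together at most `4 * h ^ (j + 1) * k * ν`, which adds up to the bound for `k + 1`. -/
theorem Good.step {j : ℕ} (hj : j < d) {S : List (Fin d → ℝ)} {o : Fin d → ℝ} {c : ℝ}
    (hc : IsMedian ⟨j, hj⟩ c S) {N N₁ N₂ : Network d}
    (hN : Good j S (Function.update o ⟨j, hj⟩ c) N)
    (hN₁ : Good (j + 1) (filterLt ⟨j, hj⟩ c S) o N₁)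
    (hN₂ : Good (j + 1) (filterGt ⟨j, hj⟩ c S) o N₂) :
    Good (j + 1) S o (N ++ (N₁ ++ N₂)) where
  rectilinear := hN.rectilinear.append (hN₁.rectilinear.append hN₂.rectilinear)
  connects p hp q hq ho := by
    by_cases hcpq : c ∈ Set.uIcc (p ⟨j, hj⟩) (q ⟨j, hj⟩)
    · refine (hN.connects p hp q hq fun i hi => ?_).mono fun s hs => List.mem_append_left _ hs
      by_cases hij : i = ⟨j, hj⟩
      · subst hij; simpa using hcpq
      · rw [Function.update_of_ne hij]
        exact ho i (by have : (i : ℕ) ≠ j := fun h => hij (Fin.ext h); omega)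
    · have hcases : (p ⟨j, hj⟩ < c ∧ q ⟨j, hj⟩ < c) ∨ (c < p ⟨j, hj⟩ ∧ c < q ⟨j, hj⟩) := by
        rw [Set.mem_uIcc] at hcpq
        grind
      rcases hcases with ⟨h1, h2⟩ | ⟨h1, h2⟩
      · exact (hN₁.connects p (by simp [filterLt, hp, h1]) q (by simp [filterLt, hq, h2])
          ho).mono fun s hs => List.mem_append_right _ (List.mem_append_left _ hs)
      · exact (hN₂.connects p (by simp [filterGt, hp, h1]) q (by simp [filterGt, hq, h2])
          ho).mono fun s hs => List.mem_append_right _ (List.mem_append_right _ hs)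
  length_le X R hX hR hSR hSX h k hkh hk := by
    cases k with
    | zero =>
      have hS : S = [] := by simpa using hk
      subst hS
      have e0 := hN.length_le X R hX hR hSR hSX h 0 h.zero_le (by simp)
      have e1 := hN₁.length_le X R hX hR (by simp [filterLt]) (by simp [filterLt]) h 0 h.zero_le
        (by simp [filterLt])
      have e2 := hN₂.length_le X R hX hR (by simp [filterGt]) (by simp [filterGt]) h 0 h.zero_le
        (by simp [filterGt])
      rw [Network.length_append, Network.length_append]
      simp only [Nat.cast_zero, mul_zero, zero_mul] at *
      linarith
    | succ k =>
      set i : Fin d := ⟨j, hj⟩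
      set ν : Measure (Fin d → ℝ) := μH[1]
      have hmeas : MeasurableSet {x : Fin d → ℝ | x i < c} :=
        measurableSet_lt (measurable_pi_apply i) measurable_const
      -- The crossing pairs are charged with depth `h` instead of `k + 1`, giving the same cost at
      -- every depth of the recursion.
      have e0 := hN.length_le X R hX hR hSR hSX h h le_rfl
        (hk.trans_le (Nat.pow_le_pow_right (by omega) hkh))
      have e1 := hN₁.length_le X (R ∩ {x | x i < c}) hX
        (fun a ha b hb m hm => ⟨hR a ha.1 b hb.1 m hm, by
          have h1 := ha.2; have h2 := hb.2; have h3 := hm i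
          simp only [Set.mem_ofPred_eq, Set.mem_uIcc] at h1 h2 h3 ⊢
          grind⟩)
        (fun p hp => by
          simp only [filterLt, List.mem_filter, decide_eq_true_eq] at hp
          exact ⟨hSR p hp.1, hp.2⟩)
        (fun p hp q hq => hSX p (List.mem_filter.1 hp).1 q (List.mem_filter.1 hq).1) h k
        (by omega) (by have := hc.1; rw [pow_succ] at hk; omega)
      have e2 := hN₂.length_le X (R ∩ {x | c < x i}) hX
        (fun a ha b hb m hm => ⟨hR a ha.1 b hb.1 m hm, by
          have h1 := ha.2; have h2 := hb.2; have h3 := hm i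
          simp only [Set.mem_ofPred_eq, Set.mem_uIcc] at h1 h2 h3 ⊢
          grind⟩)
        (fun p hp => by
          simp only [filterGt, List.mem_filter, decide_eq_true_eq] at hp
          exact ⟨hSR p hp.1, hp.2⟩)
        (fun p hp q hq => hSX p (List.mem_filter.1 hp).1 q (List.mem_filter.1 hq).1) h k
        (by omega) (by have := hc.2; rw [pow_succ] at hk; omega)
      have hfin : ν (X ∩ R) ≠ ⊤ := ne_top_of_le_ne_top hX (measure_mono Set.inter_subset_left)
      -- The halves are disjoint; whatever lies on the hyperplane is dropped.
      have e3 : ν.real (X ∩ (R ∩ {x | x i < c})) + ν.real (X ∩ (R ∩ {x | c < x i})) ≤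
          ν.real (X ∩ R) := by
        rw [← Set.inter_assoc, ← Set.inter_assoc,
          ← measureReal_inter_add_sdiff (s := X ∩ R) hmeas hfin]
        gcongr
        · exact ne_top_of_le_ne_top hfin (measure_mono Set.sdiff_subset)
        · intro x hx
          exact ⟨hx.1, fun h : x i < c => lt_asymm h (show c < x i from hx.2)⟩
      rw [Network.length_append, Network.length_append]
      have e4 := mul_le_mul_of_nonneg_left e3 (by positivity : (0 : ℝ) ≤ 4 * h ^ (j + 1) * k)
      have e5 : (4 : ℝ) * h ^ j * h = 4 * h ^ (j + 1) := by ring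
      rw [e5] at e0
      push_cast
      linarith

end net

/-! ### Running time of the divide and conquer -/

section main

open RealProg MeasureTheory Measure

variable {d : ℕ}

/-- The coordinates of a point from `j` on, as a value. -/
def encodeFrom (j : ℕ) (o : Fin d → ℝ) : Val :=
  encodeList ((List.ofFn fun i => Val.num (o i)).drop j)

theorem encodeFrom_self (o : Fin d → ℝ) : encodeFrom d o = .nil := by
  rw [encodeFrom, List.drop_eq_nil_of_le (by simp)]
  rfl

/-- Level `j` reads the centre only from coordinate `j` on, so fixing coordinate `j` amounts to
putting `c` in front of the stored list. -/
theorem encodeFrom_update {j : ℕ} (hj : j < d) (o : Fin d → ℝ) (c : ℝ) :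
    encodeFrom j (Function.update o ⟨j, hj⟩ c) = .pair (.num c) (encodeFrom (j + 1) o) := by
  unfold encodeFrom
  rw [List.drop_eq_getElem_cons (by simpa using hj)]
  simp only [List.getElem_ofFn, Function.update_self, encodeList]
  congr 2
  apply List.ext_getElem (by simp)
  intro k h1 h2
  simp only [List.getElem_drop, List.getElem_ofFn]
  rw [Function.update_of_ne]
  intro h
  have := congrArg Fin.val h
  simp only at this
  omega

/-- On input `S`, the function `netBody` computes a good network in at most `k` steps. -/
def RunsNet (j : ℕ) (S : List (Fin d → ℝ)) (k : ℕ) : Prop :=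
  ∀ (o : Fin d → ℝ) (acc : Network d), ∃ N, Good j S o N ∧
    Runs [.pair (.pair (.num (j : ℝ)) (encodePoints S)) (.pair (encodeFrom j o)
      (encodeNetwork acc))] netBody (encodeNetwork (N ++ acc)) k

theorem runsNet_nil (j : ℕ) : RunsNet j ([] : List (Fin d → ℝ)) 20 := fun o _ =>
  ⟨[], good_nil j o, (Runs.split_pair (.var rfl) (.split_pair (.var rfl) (.split_pair (.var rfl)
    (.split_nil (.var rfl) (.var rfl))))).mono (by omega)⟩

theorem runsNet_zero {n : ℕ} {S : List (Fin d → ℝ)} (hS : S.Nodup) (hn : S.length ≤ n) :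
    RunsNet 0 S (1000 * (d + 1) ^ 2 * (n + 1) ^ 3) := by
  have hpos : 1 ≤ (d + 1) ^ 2 * (n + 1) ^ 3 := Nat.one_le_iff_ne_zero.2 (by positivity)
  cases S with
  | nil =>
    intro o acc
    obtain ⟨N, h1, h2⟩ := runsNet_nil (d := d) 0 o acc
    exact ⟨N, h1, h2.mono (by rw [mul_assoc]; omega)⟩
  | cons p S =>
    intro o acc
    obtain ⟨l, r, hr, hl, hlr, hrun⟩ := runs_prim n S.length [p] S rfl (by simp)
      (by simpa [add_comm] using hn)
    obtain ⟨N, hN, hrun'⟩ := runs_rounds o n l (by simpa [hl.length_eq, add_comm] using hn) acc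
    refine ⟨N, good_zero hS hr hl (by simpa using hlr) hN, ?_⟩
    have hS' : S.length + 1 ≤ n + 1 := by simp at hn; omega
    have hl' : l.length + 1 ≤ n + 1 := by simp [hl.length_eq] at hn ⊢; omega
    refine (Runs.split_pair (.var rfl) (.split_pair (.var rfl) (.split_pair (.var rfl)
      (.split_pair (.var rfl) (.ifLe_true (.var rfl) (.lit rfl) (by simp)
        (.call rfl (.pair
          (.call rfl (.pair (.pair (.var rfl) .nil) (.var rfl))
            (hrun.mono (Nat.mul_le_mul_right _ hS')))
          (.pair (.var rfl) (.var rfl)))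
          (hrun'.mono (Nat.mul_le_mul_right _ hl')))))))).mono ?_
    ring_nf
    omega

/-- The median point belongs to neither side; this keeps the recursion tree linear in size. -/
theorem length_filterLt_add_filterGt {i : Fin d} {p : Fin d → ℝ} {S : List (Fin d → ℝ)}
    (hp : p ∈ S) : (filterLt i (p i) S).length + (filterGt i (p i) S).length + 1 ≤ S.length := by
  have h1 := List.length_eq_length_filter_add (l := S) fun q => decide (q i < p i)
  have h2 : (filterGt i (p i) S).Sublist (S.filter fun q => !decide (q i < p i)) := by
    refine List.monotone_filter_right S fun q hq => ?_
    simp only [decide_eq_true_eq, Bool.not_eq_true', decide_eq_false_iff_not, not_lt] at hq ⊢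
    exact hq.le
  have h3 : p ∈ S.filter fun q => !decide (q i < p i) := by simp [hp]
  have h4 : p ∉ filterGt i (p i) S := by simp [filterGt]
  have h5 := h2.length_le
  have h6 : (filterGt i (p i) S).length ≠ (S.filter fun q => !decide (q i < p i)).length :=
    fun h => h4 (h2.eq_of_length h ▸ h3)
  unfold filterLt
  omega

/-- The recursion tree, with its empty leaves, has at most `2 * m + 1` nodes. Each costs one call of
the level below plus the median search and the filters. -/
theorem runsNet_succ {j n T : ℕ} (hj : j < d)
    (hT : ∀ S : List (Fin d → ℝ), S.Nodup → S.length ≤ n → RunsNet j S T) :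
    ∀ (m : ℕ) (S : List (Fin d → ℝ)), S.length = m → S.Nodup → m ≤ n →
      RunsNet (j + 1) S ((2 * m + 1) * (T + 1000 * (d + 1) * (n + 1) ^ 2)) := by
  intro m
  induction m using Nat.strong_induction_on with
  | _ m ih =>
  intro S hm hS hmn o acc
  set B := T + 1000 * (d + 1) * (n + 1) ^ 2 with hB
  rcases S.eq_nil_or_concat with rfl | hne
  · obtain ⟨N, h1, h2⟩ := runsNet_nil (d := d) (j + 1) o acc
    have : 1 ≤ (d + 1) * (n + 1) ^ 2 := Nat.one_le_iff_ne_zero.2 (by positivity)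
    refine ⟨N, h1, h2.mono ?_⟩
    calc 20 ≤ B := by rw [hB, mul_assoc]; omega
      _ ≤ _ := Nat.le_mul_of_pos_left _ (by omega)
  obtain ⟨p, S', rfl⟩ : ∃ p S', S = p :: S' := by
    cases S with
    | nil => obtain ⟨_, _, h⟩ := hne; simp at h
    | cons p S' => exact ⟨p, S', rfl⟩
  set S := p :: S' with hSdef
  set i : Fin d := ⟨j, hj⟩ with hi
  obtain ⟨q, hq, hmed, hfind⟩ := runs_findMed i S S
    (exists_isMedian i (by simp [hSdef]))
  have hlen := length_filterLt_add_filterGt (i := i) hq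
  -- Arguments are evaluated first, so the innermost network `N₂` becomes the accumulator for `N₁`,
  -- and both that for `N`.
  obtain ⟨N₂, hg₂, hrun₂⟩ := ih _ (by omega) (filterGt i (q i) S) rfl (hS.filter _) (by omega) o acc
  obtain ⟨N₁, hg₁, hrun₁⟩ := ih _ (by omega) (filterLt i (q i) S) rfl (hS.filter _) (by omega) o
    (N₂ ++ acc)
  obtain ⟨N, hg, hrun⟩ := hT S hS (by omega) (Function.update o i (q i)) (N₁ ++ (N₂ ++ acc))
  refine ⟨N ++ (N₁ ++ N₂), hg.step hj hmed hg₁ hg₂, ?_⟩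
  rw [encodeFrom_update] at hrun
  rw [List.append_assoc, List.append_assoc]
  have hflt := (runs_filterLt i (q i) S).mono (n := 50 * (d + 1) * (n + 1)) (by gcongr; omega)
  have hfgt := (runs_filterGt i (q i) S).mono (n := 50 * (d + 1) * (n + 1)) (by gcongr; omega)
  have hfind' := hfind.mono (n := (n + 1) * (300 * (d + 1) * (n + 1))) (by gcongr <;> omega)
  refine (Runs.split_pair (.var rfl) (.split_pair (.var rfl) (.split_pair (.var rfl)
    (.split_pair (.var rfl) (.ifLe_false (.var rfl) (.lit rfl) ?_
      (.letIn (.sub (.var rfl) (.lit rfl) (u := (j : ℝ)) ?_)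
        (.letIn (.call rfl (.pair (.var rfl) (.pair (.var rfl) (.var rfl))) hfind')
          (.call rfl (.pair (.pair (.var rfl) (.var rfl)) (.pair (.pair (.var rfl) (.var rfl))
            (.call rfl (.pair (.pair (.var rfl)
                (.call rfl (.pair (.var rfl) (.pair (.var rfl) (.var rfl))) hflt))
              (.pair (.var rfl)
                (.call rfl (.pair (.pair (.var rfl)
                    (.call rfl (.pair (.var rfl) (.pair (.var rfl) (.var rfl))) hfgt))
                  (.pair (.var rfl) (.var rfl))) hrun₂))) hrun₁))) hrun)))))))).mono ?_
  · rw [not_le]; push_cast; positivity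
  · push_cast; ring
  -- If the sides have `a` and `b` points with `a + b + 1 ≤ m`, then `(2 * a + 1) + (2 * b + 1) + 1
  -- ≤ 2 * m + 1`.
  · have h1 : (2 * (filterLt i (q i) S).length + 1) * B +
        (2 * (filterGt i (q i) S).length + 1) * B + B ≤ (2 * m + 1) * B := by
      rw [← add_mul, ← add_one_mul]
      exact Nat.mul_le_mul_right _ (by omega)
    have h2 : T + (n + 1) * (300 * (d + 1) * (n + 1)) + 100 * (d + 1) * (n + 1) + 100 ≤ B := by
      rw [hB]; ring_nf; omega
    have h3 : 100 * (d + 1) * (n + 1) = 2 * (50 * (d + 1) * (n + 1)) := by ring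
    omega

theorem exists_runsNet : ∀ j ≤ d, ∃ T : Polynomial ℕ, ∀ (n : ℕ) (S : List (Fin d → ℝ)),
    S.Nodup → S.length ≤ n → RunsNet j S (T.eval n)
  | 0, _ => ⟨.C (1000 * (d + 1) ^ 2) * (.X + 1) ^ 3, fun n S hS hn => by
      simpa using runsNet_zero hS hn⟩
  | j + 1, hj => by
    obtain ⟨T, hT⟩ := exists_runsNet j (by omega)
    refine ⟨(.C 2 * .X + 1) * (T + .C (1000 * (d + 1)) * (.X + 1) ^ 2), fun n S hS hn o acc => ?_⟩
    obtain ⟨N, h1, h2⟩ := runsNet_succ hj (hT n) S.length S rfl hS hn o acc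
    refine ⟨N, h1, h2.mono ?_⟩
    simp only [Polynomial.eval_mul, Polynomial.eval_add, Polynomial.eval_C, Polynomial.eval_X,
      Polynomial.eval_one, Polynomial.eval_pow]
    gcongr

/-! ### The approximation ratio -/

theorem length_le_of_good {n : ℕ} {t : Fin n → Fin d → ℝ} {o : Fin d → ℝ} {N N' : Network d}
    (hN : Good d (List.ofFn t) o N) (hN' : IsManhattanNetwork t N') (k : ℕ) (hk : n < 2 ^ k) :
    N.length ≤ 4 * k ^ (d + 1) * N'.length := by
  have h0 : 0 ≤ N'.length := Network.length_nonneg N'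
  have hμ := Network.measure_support_le hN'.1
  have h := hN.length_le N'.support Set.univ (ne_top_of_le_ne_top ENNReal.ofReal_ne_top hμ)
    (fun _ _ _ _ _ _ => trivial) (fun _ _ => trivial) (by
      simp only [List.mem_ofFn', Set.mem_range]
      rintro _ ⟨i, rfl⟩ _ ⟨j, rfl⟩
      exact hN'.2 i j) k k le_rfl (by simpa using hk)
  rw [Set.inter_univ] at h
  have h2 : (μH[1] : Measure (Fin d → ℝ)).real N'.support ≤ N'.length :=
    ENNReal.toReal_le_of_le_ofReal h0 hμ
  refine h.trans ?_
  rw [mul_assoc 4, ← pow_succ]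
  gcongr

/-- Both `Nat.log 2 n` and `1` are at most `Real.log n / Real.log 2`, and `2 / 0.69 < 3`. -/
theorem log_two_add_one_le {n : ℕ} (hn : 2 ≤ n) : ((Nat.log 2 n + 1 : ℕ) : ℝ) ≤ 3 * Real.log n := by
  have h2 : (2 : ℝ) ≤ n := by exact_mod_cast hn
  have hlog : Real.log 2 ≤ Real.log n := Real.log_le_log (by norm_num) h2
  have h1 : (Nat.log 2 n : ℝ) * Real.log 2 ≤ Real.log n := by
    rw [← Real.log_pow]
    refine Real.log_le_log (by positivity) ?_
    exact_mod_cast Nat.pow_log_le_self 2 (by omega)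
  have h3 : (0.69 : ℝ) < Real.log 2 := by linarith [Real.log_two_gt_d9]
  have h4 : 0 ≤ (Nat.log 2 n : ℝ) := Nat.cast_nonneg _
  push_cast
  nlinarith

end main

end Manhattan

theorem mainTheorem2 (d : ℕ) :
    ∃ C : ℝ, 0 < C ∧
      Manhattan.AdmitsApproximation d (fun n => C * Real.log (n : ℝ) ^ (d + 1)) := by
  open Manhattan RealProg in
  obtain ⟨T, hT⟩ := exists_runsNet d le_rfl
  -- The 4 comes from level 0 and each 3 from replacing `Nat.log 2 n + 1` by the natural logarithm;
  -- `10` covers the set-up in the main expression.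
  refine ⟨4 * 3 ^ (d + 1), by positivity, program d, T + .C 10, fun n t ht => ?_⟩
  -- At level `d` no coordinate of the centre is read, so `0` is an arbitrary choice.
  obtain ⟨N, hN, c, hc, hrun⟩ := hT n (List.ofFn t) (List.nodup_ofFn.2 ht) (by simp) 0 []
  rw [List.append_nil, encodeFrom_self] at hrun
  have hterm : encodePoints (List.ofFn t) = encodeTerminals t := by
    simp [encodePoints, encodeTerminals, List.map_ofFn, Function.comp_def]
  rw [hterm] at hrun
  have hnet : IsManhattanNetwork t N := by
    refine ⟨hN.rectilinear, fun i j => hN.connects _ ?_ _ ?_ fun k hk => absurd k.2 (by omega)⟩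
    all_goals simp [List.mem_ofFn']
  have hlit : Eval funs [encodeTerminals t] (.lit d) (.num (d : ℝ)) 1 := by
    simpa using Eval.lit (F := funs) (ρ := [encodeTerminals t]) (z := d)
  refine ⟨N, _, Eval.call rfl (.pair (.pair hlit (.var rfl)) (.pair .nil .nil)) hrun,
    by simp; omega, hnet, fun N' hN' => ?_⟩
  have h0 : 0 ≤ N'.length := Network.length_nonneg N'
  rcases Nat.lt_or_ge n 2 with hn | hn
  -- Here the logarithm vanishes, so the output must have length 0. Comparison with the empty
  -- network, feasible for at most one terminal, shows this.
  · have hsub : IsManhattanNetwork t [] := by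
      refine ⟨by simp [Network.IsRectilinear], fun i j => ?_⟩
      have : i = j := Fin.ext (by omega)
      rw [this]
      exact .refl _ _
    have h1 := length_le_of_good hN hsub n n.lt_two_pow_self
    rw [Network.length_nil, mul_zero] at h1
    refine h1.trans (mul_nonneg (mul_nonneg (by positivity) (pow_nonneg ?_ _)) h0)
    exact Real.log_natCast_nonneg n
  · have h1 := length_le_of_good hN hN' (Nat.log 2 n + 1) (Nat.lt_pow_succ_log_self (by omega) n)
    refine h1.trans (mul_le_mul_of_nonneg_right ?_ h0)
    dsimp only
    rw [mul_assoc, ← mul_pow]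
    gcongr
    exact log_two_add_one_le hn
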